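/- Let $n\ge 1$ and let $\Omega\subset\mathbb{R}^n$ be a nonempty, open, bounded and convex set. Let $A:\Omega\to\mathbb{R}^{n\times n}$ be Lipschitz continuous, symmetric and uniformly positive definite, let $0\le c\in L^\infty(\Omega)$, and let $\mathcal{L}w=-\operatorname{div}(A\nabla w)+cw$, supplemented with homogeneous Dirichlet boundary conditions. Then there are eigenpairs $(\lambda_k,\varphi_k)_{k\in\mathbb N}\subset\mathbb{R}_+\times H^1_0(\Omega)$ of $\mathcal{L}$, i.e. $\int_\Omega (A\nabla\varphi_k\cdot\nabla v+c\varphi_k v)=\lambda_k\int_\Omega\varphi_k v$ for all $v\in H_0^1(\Omega)$, such that $(\varphi_k)$ is an orthonormal basis of $L^2(\Omega)$. For any such eigenpairs and $s\ge 0$, write $w_k=(w,\varphi_k)_{L^2(\Omega)}$ and let $\mathbb{H}^s(\Omega)$ be the space of $w\in L^2(\Omega)$ with $\|w\|_{\mathbb{H}^s(\Omega)}^2:=\sum_k\lambda_k^s|w_k|^2<\infty$, let $\mathbb{H}^{-s}(\Omega)$ be its dual, with duality pairing $\langle\cdot,\cdot\rangle$ extending the inner product of $L^2(\Omega)$, and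 let $\mathcal{L}^s:\mathbb{H}^s(\Omega)\to\mathbb{H}^{-s}(\Omega)$ be given by $\langle\mathcal{L}^sw,v\rangle=\sum_k\lambda_k^sw_kv_k$. Let $s\in(0,1)$ and $T>0$. There is a constant $C>0$, depending only on $\Omega,A,c,s,T$, such that the following holds for all $f\in L^2(0,T;L^2(\Omega))$, $g\in\mathbb{H}^s(\Omega)$ and $h\in L^2(\Omega)$. The problem $\partial_t^2u+\mathcal{L}^su=f$ in $\Omega\times(0,T)$, $u(0)=g$, $\partial_tu(0)=h$ has a unique weak solution, that is, there is exactly one $u\in L^2(0,T;\mathbb{H}^s(\Omega))$ with distributional time derivatives $\partial_tu\in L^2(0,T;L^2(\Omega))$ and $\partial_t^2u\in L^2(0,T;\mathbb{H}^{-s}(\Omega))$ such that $u(0)=g$, $\partial_tu(0)=h$ (in the sense of the continuous representatives $u\in C([0,T];L^2(\Omega))$ and $\partial_tu\in C([0,T];\mathbb{H}^{-s}(\Omega))$) and, for a.e. $t\in(0,T)$, $$\langle\partial_t^2u(t),v\rangle+\langle\mathcal{L}^su(t),v\rangle=\langle f(t),v\rangle\qquad\forall v\in\mathbb{H}^s(\Omega).$$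 Moreover, $$\|u\|_{L^\infty(0,T;\mathbb{H}^s(\Omega))}+\|\partial_tu\|_{L^\infty(0,T;L^2(\Omega))}\le C\left(\|f\|_{L^2(0,T;L^2(\Omega))}+\|g\|_{\mathbb{H}^s(\Omega)}+\|h\|_{L^2(\Omega)}\right).$$ -/

import Mathlib

open MeasureTheory Set Filter Topology
open scoped ENNReal NNReal ContDiff

noncomputable section

namespace FracWave

/-- Data of the elliptic operator `𝓛 w = -div (A ∇w) + c w` with homogeneous Dirichlet conditions:
a nonempty open bounded convex `Ω ⊆ ℝⁿ`, `n ≥ 1`, a Lipschitz, symmetric, uniformly positive definite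
matrix field `A` on `Ω`, and a nonnegative `c ∈ L^∞(Ω)`. Values outside `Ω` are irrelevant. -/
structure EllipticOperator (n : ℕ) where
  /-- The domain `Ω`. -/
  Ω : Set (EuclideanSpace ℝ (Fin n))
  /-- The diffusion matrix. -/
  A : EuclideanSpace ℝ (Fin n) → Matrix (Fin n) (Fin n) ℝ
  /-- The reaction coefficient. -/
  c : EuclideanSpace ℝ (Fin n) → ℝ
  one_le_dim : 1 ≤ n
  isOpen : IsOpen Ω
  nonempty : Ω.Nonempty
  bounded : Bornology.IsBounded Ω
  convex : Convex ℝ Ω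
  lipschitz : ∃ K : ℝ≥0, ∀ i j, LipschitzOnWith K (fun x => A x i j) Ω
  symmetric : ∀ x ∈ Ω, (A x).IsSymm
  elliptic : ∃ α > 0, ∀ x ∈ Ω, ∀ ξ : EuclideanSpace ℝ (Fin n),
    α * ‖ξ‖ ^ 2 ≤ ∑ i, ∑ j, A x i j * ξ j * ξ i
  c_memLp : MemLp c ∞ (volume.restrict Ω)
  c_nonneg : ∀ᵐ x ∂volume.restrict Ω, 0 ≤ c x

variable {n : ℕ}

/-- `L²(Ω)`. -/
abbrev L2 (P : EllipticOperator n) : Type := Lp ℝ 2 (volume.restrict P.Ω)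

/-- `L²(Ω; ℝⁿ)`. -/
abbrev L2Vec (P : EllipticOperator n) : Type :=
  Lp (EuclideanSpace ℝ (Fin n)) 2 (volume.restrict P.Ω)

/-- The pairs `(φ, ∇φ)` with `φ ∈ C_c^∞(Ω)`. -/
def testPairs (P : EllipticOperator n) : Set (L2 P × L2Vec P) :=
  {p | ∃ φ : EuclideanSpace ℝ (Fin n) → ℝ, ContDiff ℝ ∞ φ ∧ HasCompactSupport φ ∧
    tsupport φ ⊆ P.Ω ∧ p.1 =ᵐ[volume.restrict P.Ω] φ ∧ p.2 =ᵐ[volume.restrict P.Ω] gradient φ}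

/-- `H¹₀(Ω)`, the closure of `C_c^∞(Ω)` in the `H¹` norm, as the set of pairs `(w, ∇w)` of a
function of `H¹₀(Ω)` and its weak gradient. -/
def H10 (P : EllipticOperator n) : Set (L2 P × L2Vec P) := closure (testPairs P)

/-- The bilinear form `∫_Ω A∇w·∇v + c w v` of `𝓛`, on pairs (function, gradient). -/
def form (P : EllipticOperator n) (p q : L2 P × L2Vec P) : ℝ :=
  ∫ x in P.Ω, ((∑ i, ∑ j, P.A x i j * p.2 x j * q.2 x i) + P.c x * p.1 x * q.1 x)

/-- `φ ∈ H¹₀(Ω) \ {0}` and `𝓛 φ = lam φ` in `Ω`, in the weak sense. -/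
def IsEigenpair (P : EllipticOperator n) (lam : ℝ) (φ : L2 P) : Prop :=
  φ ≠ 0 ∧ ∃ G : L2Vec P, (φ, G) ∈ H10 P ∧ ∀ q ∈ H10 P, form P (φ, G) q = lam * inner ℝ φ q.1

/-- A countable collection of eigenpairs of `𝓛` whose eigenfunctions form an orthonormal basis
of `L²(Ω)`. -/
structure Eigenbasis (P : EllipticOperator n) where
  /-- The eigenvalues. -/
  eigval : ℕ → ℝ
  /-- The orthonormal basis of eigenfunctions. -/
  basis : HilbertBasis ℕ ℝ (L2 P)
  isEigenpair : ∀ k, IsEigenpair P (eigval k) (basis k)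

/-! ### The eigenvalues are bounded below by a positive constant -/

theorem norm_sq_eq_integral {E F : Type*} [MeasurableSpace E] {μ : Measure E}
    [NormedAddCommGroup F] [InnerProductSpace ℝ F] (w : Lp F 2 μ) :
    ‖w‖ ^ 2 = ∫ x, ‖w x‖ ^ 2 ∂μ := by
  rw [← real_inner_self_eq_norm_sq, L2.inner_def]
  simp only [real_inner_self_eq_norm_sq]

theorem integral_sq_le_of_test (P : EllipticOperator n) {R : ℝ} (hR : 0 < R)
    (hΩ : ∀ x ∈ P.Ω, ‖x‖ ≤ R) {φ : EuclideanSpace ℝ (Fin n) → ℝ} (hφ : ContDiff ℝ ∞ φ)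
    (hc : HasCompactSupport φ) (hsupp : tsupport φ ⊆ P.Ω) :
    ∫ x in P.Ω, φ x ^ 2 ≤ 4 * R ^ 2 * ∫ x in P.Ω, ‖gradient φ x‖ ^ 2 := by
  have hd : Differentiable ℝ φ := hφ.differentiable (by simp)
  have hgc : Continuous (gradient φ) := by
    unfold gradient
    exact (LinearIsometryEquiv.continuous _).comp (hφ.continuous_fderiv (by simp))
  have hgs : HasCompactSupport (gradient φ) := by
    have h1 := hc.fderiv (𝕜 := ℝ)
    exact h1.comp_left (g := (InnerProductSpace.toDual ℝ _).symm) (map_zero _)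
  have hgz : ∀ x, x ∉ P.Ω → gradient φ x = 0 := fun x hx => by
    have : fderiv ℝ φ x = 0 := by
      by_contra h
      exact hx (hsupp (support_fderiv_subset ℝ h))
    simp [gradient, this]
  have hφz : ∀ x, x ∉ P.Ω → φ x = 0 := fun x hx => by
    by_contra h
    exact hx (hsupp (subset_tsupport _ h))
  have e1 : ∫ x in P.Ω, φ x ^ 2 = ∫ x, φ x ^ 2 :=
    setIntegral_eq_integral_of_forall_compl_eq_zero fun x hx => by simp [hφz x hx]
  have e2 : ∫ x in P.Ω, ‖gradient φ x‖ ^ 2 = ∫ x, ‖gradient φ x‖ ^ 2 :=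
    setIntegral_eq_integral_of_forall_compl_eq_zero fun x hx => by simp [hgz x hx]
  have hsq : HasCompactSupport fun x => φ x ^ 2 := by
    simp only [sq]
    exact hc.mul_left
  have i1 : Integrable fun x => φ x ^ 2 :=
    (hφ.continuous.pow 2).integrable_of_hasCompactSupport hsq
  have i2 : Integrable fun x => ‖gradient φ x‖ ^ 2 :=
    (hgc.norm.pow 2).integrable_of_hasCompactSupport
      (by
        simp only [sq]
        exact hgs.norm.mul_left)
  obtain ⟨ℓ, v, hℓ, hℓv, hv⟩ : ∃ (ℓ : EuclideanSpace ℝ (Fin n) →L[ℝ] ℝ)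
      (v : EuclideanSpace ℝ (Fin n)), (∀ x, |ℓ x| ≤ ‖x‖) ∧ ℓ v = 1 ∧ ‖v‖ = 1 :=
    ⟨EuclideanSpace.proj ⟨0, P.one_le_dim⟩, EuclideanSpace.single ⟨0, P.one_le_dim⟩ 1,
      fun x => PiLp.norm_apply_le x _, by simp, by simp⟩
  have hdsq : ∀ x, fderiv ℝ (fun y => φ y ^ 2) x v = 2 * φ x * inner ℝ (gradient φ x) v := by
    intro x
    rw [fderiv_fun_pow _ (hd x)]
    simp [gradient]
  have i3 : Integrable fun x => ℓ x * fderiv ℝ (fun y => φ y ^ 2) x v := by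
    simp only [hdsq]
    refine Continuous.integrable_of_hasCompactSupport ?_ ?_
    · have := hφ.continuous
      fun_prop
    · refine HasCompactSupport.mul_left (HasCompactSupport.mul_right ?_)
      exact hc.mul_left
  have ibp := integral_mul_fderiv_eq_neg_fderiv_mul_of_integrable (μ := volume)
    (f := fun x => ℓ x) (g := fun x => φ x ^ 2) (v := v)
    (by simpa [hℓv] using i1) i3
    ((ℓ.continuous.mul (hφ.continuous.pow 2)).integrable_of_hasCompactSupport
      hsq.mul_left)
    (fun x _ => ℓ.differentiableAt) (fun x _ => (hd x).pow 2)
  simp only [ContinuousLinearMap.fderiv, hℓv, one_mul] at ibp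
  have key : ∫ x, φ x ^ 2 ≤ ∫ x, (φ x ^ 2 / 2 + 2 * R ^ 2 * ‖gradient φ x‖ ^ 2) := by
    rw [← neg_eq_iff_eq_neg.mpr ibp, ← integral_neg]
    refine integral_mono i3.neg ((i1.div_const 2).add (i2.const_mul _)) fun x => ?_
    simp only [hdsq]
    by_cases hx : x ∈ P.Ω
    · have h1 : |ℓ x| ≤ R := (hℓ x).trans (hΩ x hx)
      have h2 : |inner ℝ (gradient φ x) v| ≤ ‖gradient φ x‖ := by
        simpa [hv] using abs_real_inner_le_norm (gradient φ x) v
      have h3 : |ℓ x * inner ℝ (gradient φ x) v| ≤ R * ‖gradient φ x‖ := by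
        rw [abs_mul]
        gcongr
      have h4 := sq_le_sq' (by linarith [neg_abs_le (ℓ x * inner ℝ (gradient φ x) v)])
        ((le_abs_self _).trans h3)
      nlinarith [sq_nonneg (φ x + 2 * (ℓ x * inner ℝ (gradient φ x) v))]
    · simp [hφz x hx]
      positivity
  rw [integral_add (i1.div_const 2) (i2.const_mul _), integral_div, integral_const_mul] at key
  rw [e1, e2]
  linarith

theorem poincare (P : EllipticOperator n) :
    ∃ K > 0, ∀ p ∈ H10 P, ‖p.1‖ ^ 2 ≤ K * ‖p.2‖ ^ 2 := by
  obtain ⟨R, hR, hΩ⟩ := P.bounded.exists_pos_norm_le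
  refine ⟨4 * R ^ 2, by positivity, fun p hp => ?_⟩
  have hcl : IsClosed {p : L2 P × L2Vec P | ‖p.1‖ ^ 2 ≤ 4 * R ^ 2 * ‖p.2‖ ^ 2} :=
    isClosed_le (by fun_prop) (by fun_prop)
  refine closure_minimal ?_ hcl hp
  intro q hq
  obtain ⟨φ, hφ, hc, hsupp, hw, hG⟩ := hq
  have h := integral_sq_le_of_test P hR hΩ hφ hc hsupp
  have e1 : ‖q.1‖ ^ 2 = ∫ x in P.Ω, φ x ^ 2 := by
    rw [norm_sq_eq_integral]
    refine integral_congr_ae ?_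
    filter_upwards [hw] with x hx
    simp [hx]
  have e2 : ‖q.2‖ ^ 2 = ∫ x in P.Ω, ‖gradient φ x‖ ^ 2 := by
    rw [norm_sq_eq_integral]
    refine integral_congr_ae ?_
    filter_upwards [hG] with x hx
    simp [hx]
  change ‖q.1‖ ^ 2 ≤ 4 * R ^ 2 * ‖q.2‖ ^ 2
  rw [e1, e2]
  exact h

theorem form_coercive (P : EllipticOperator n) :
    ∃ α > 0, ∀ p : L2 P × L2Vec P, α * ‖p.2‖ ^ 2 ≤ form P p p := by
  obtain ⟨α, hα, hell⟩ := P.elliptic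
  obtain ⟨K, hK⟩ := P.lipschitz
  refine ⟨α, hα, fun p => ?_⟩
  have hmeas := P.isOpen.measurableSet
  have hcomp : ∀ i, MemLp (fun x => p.2 x i) 2 (volume.restrict P.Ω) := fun i =>
    (EuclideanSpace.proj (𝕜 := ℝ) i).comp_memLp' (Lp.memLp p.2)
  have hA : ∀ i j, MemLp (fun x => P.A x i j) ∞ (volume.restrict P.Ω) := fun i j => by
    obtain ⟨x₀, hx₀⟩ := P.nonempty
    obtain ⟨D, hD⟩ := P.bounded.exists_norm_le
    refine memLp_top_of_bound ((hK i j).continuousOn.aestronglyMeasurable hmeas)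
      (‖P.A x₀ i j‖ + K * (D + D)) ?_
    filter_upwards [ae_restrict_mem hmeas] with x hx
    have h1 := (hK i j).norm_sub_le hx hx₀
    have h2 : ‖x - x₀‖ ≤ D + D := (norm_sub_le _ _).trans (add_le_add (hD x hx) (hD x₀ hx₀))
    have h3 := norm_le_norm_add_norm_sub' (P.A x i j) (P.A x₀ i j)
    have h4 := mul_le_mul_of_nonneg_left h2 K.2
    exact h3.trans (add_le_add le_rfl (h1.trans h4))
  have i1 : Integrable (fun x => ∑ i, ∑ j, P.A x i j * p.2 x j * p.2 x i)
      (volume.restrict P.Ω) := by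
    refine integrable_finsetSum _ fun i _ => integrable_finsetSum _ fun j _ => ?_
    have h1 : MemLp (fun x => P.A x i j * p.2 x j) 2 (volume.restrict P.Ω) :=
      (hcomp j).mul (hA i j)
    exact h1.integrable_mul (hcomp i)
  have i2 : Integrable (fun x => P.c x * p.1 x * p.1 x) (volume.restrict P.Ω) := by
    have h1 : MemLp (fun x => P.c x * p.1 x) 2 (volume.restrict P.Ω) :=
      (Lp.memLp p.1).mul P.c_memLp
    exact h1.integrable_mul (Lp.memLp p.1)
  have i3 : Integrable (fun x => ‖p.2 x‖ ^ 2) (volume.restrict P.Ω) :=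
    (Lp.memLp p.2).integrable_norm_pow (by simp)
  rw [norm_sq_eq_integral, ← integral_const_mul, form]
  refine integral_mono_ae (i3.const_mul α) (i1.add i2) ?_
  filter_upwards [ae_restrict_mem hmeas, P.c_nonneg] with x hx hcx
  have h1 := hell x hx (p.2 x)
  have h2 : 0 ≤ P.c x * p.1 x * p.1 x := by
    rw [mul_assoc]
    exact mul_nonneg hcx (mul_self_nonneg _)
  exact h1.trans (le_add_of_nonneg_right h2)

namespace Eigenbasis

variable {P : EllipticOperator n} (B : Eigenbasis P)

theorem exists_le_eigval : ∃ m > 0, ∀ k, m ≤ B.eigval k := by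
  obtain ⟨K, hK, hP⟩ := poincare P
  obtain ⟨α, hα, hc⟩ := form_coercive P
  refine ⟨α / K, by positivity, fun k => ?_⟩
  obtain ⟨-, G, hG, h⟩ := B.isEigenpair k
  have h1 := h _ hG
  have h2 := hc (B.basis k, G)
  have h3 := hP _ hG
  have h4 : ‖B.basis k‖ = 1 := B.basis.orthonormal.1 k
  rw [h1, real_inner_self_eq_norm_sq, h4] at h2
  simp only [h4] at h3
  rw [div_le_iff₀ hK]
  nlinarith

theorem eigval_pos (k : ℕ) : 0 < B.eigval k := by
  obtain ⟨m, hm, h⟩ := B.exists_le_eigval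
  exact hm.trans_le (h k)

/-- The coefficient `w_k = (w, φ_k)`. -/
def coeff (w : L2 P) (k : ℕ) : ℝ := inner ℝ (B.basis k) w

theorem coeff_add (v w : L2 P) (k : ℕ) : B.coeff (v + w) k = B.coeff v k + B.coeff w k :=
  inner_add_right _ _ _

theorem coeff_smul (a : ℝ) (w : L2 P) (k : ℕ) : B.coeff (a • w) k = a * B.coeff w k :=
  real_inner_smul_right _ _ _

theorem hasSum_coeff_sq (w : L2 P) : HasSum (fun k => B.coeff w k ^ 2) (‖w‖ ^ 2) := by
  have h := B.basis.hasSum_inner_mul_inner w w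
  rw [real_inner_self_eq_norm_sq] at h
  have e : (fun k => B.coeff w k ^ 2) =
      fun k => inner ℝ w (B.basis k) * inner ℝ (B.basis k) w := by
    funext k
    rw [sq, coeff, real_inner_comm w]
  rw [e]
  exact h

/-- `ℍ^s(Ω)` as a subspace of `L²(Ω)`: all `w = ∑ w_k φ_k` with `∑ λ_k^s |w_k|² < ∞`. -/
def HsSub (s : ℝ≥0) : Submodule ℝ (L2 P) where
  carrier := {w | Summable fun k => B.eigval k ^ (s : ℝ) * B.coeff w k ^ 2}
  zero_mem' := by simp [coeff, summable_zero]
  add_mem' := by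
    intro v w hv hw
    refine Summable.of_nonneg_of_le (fun k => ?_) (fun k => ?_) ((hv.add hw).mul_left 2)
    · have := (B.eigval_pos k).le
      positivity
    · have := Real.rpow_nonneg (B.eigval_pos k).le s
      rw [coeff_add]
      nlinarith [mul_nonneg this (sq_nonneg (B.coeff v k - B.coeff w k))]
  smul_mem' := by
    intro a w hw
    refine (Summable.mul_left (a ^ 2) hw).congr fun k => ?_
    rw [coeff_smul]
    ring

/-- `ℍ^s(Ω)`, `s ≥ 0`, with the norm `‖w‖² = ∑ λ_k^s |w_k|²`; see `Hs.norm_sq_eq`. -/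
def Hs (s : ℝ≥0) : Type := B.HsSub s

namespace Hs

variable {B} {s : ℝ≥0}

instance : AddCommGroup (B.Hs s) := inferInstanceAs (AddCommGroup (B.HsSub s))

instance : Module ℝ (B.Hs s) := inferInstanceAs (Module ℝ (B.HsSub s))

variable (B s)

/-- The inclusion of `ℍ^s(Ω)` in `L²(Ω)`, as a linear map. -/
def incl : B.Hs s →ₗ[ℝ] L2 P := (B.HsSub s).subtype

theorem incl_injective : Function.Injective (incl B s) := Subtype.val_injective

/-- The map `w ↦ (λ_k^{s/2} w_k)_k` from `ℍ^s(Ω)` to `ℓ²`. -/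
def toSeq : B.Hs s →ₗ[ℝ] lp (fun _ : ℕ => ℝ) 2 where
  toFun w := ⟨fun k => B.eigval k ^ ((s : ℝ) / 2) * B.coeff (incl B s w) k, by
    have hw : Summable fun k => B.eigval k ^ (s : ℝ) * B.coeff (incl B s w) k ^ 2 := w.2
    refine memℓp_gen (hw.congr fun k => ?_)
    have h := B.eigval_pos k
    simp only [ENNReal.toReal_ofNat, Real.rpow_two, Real.norm_eq_abs, sq_abs]
    rw [mul_pow, ← Real.rpow_natCast (B.eigval k ^ ((s : ℝ) / 2)), ← Real.rpow_mul h.le]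
    norm_num⟩
  map_add' v w := by
    ext k
    simp only [map_add, coeff_add, mul_add]
    rfl
  map_smul' a w := by
    ext k
    simp [coeff_smul]
    ring

theorem toSeq_apply (w : B.Hs s) (k : ℕ) :
    toSeq B s w k = B.eigval k ^ ((s : ℝ) / 2) * B.coeff (incl B s w) k := rfl

theorem toSeq_injective : Function.Injective (toSeq B s) := by
  rw [injective_iff_map_eq_zero]
  intro w hw
  apply incl_injective B s
  rw [map_zero]
  have h0 : ∀ k, B.coeff (incl B s w) k = 0 := fun k => by
    have h := congrArg (fun x : lp (fun _ : ℕ => ℝ) 2 => x k) hw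
    have hp := Real.rpow_pos_of_pos (B.eigval_pos k) ((s : ℝ) / 2)
    simpa [toSeq_apply, hp.ne'] using h
  have h := B.hasSum_coeff_sq (incl B s w)
  simp only [h0] at h
  have h2 := h.unique (a₂ := 0) (by simp only [sq, mul_zero]; exact hasSum_zero)
  simpa using h2

instance : NormedAddCommGroup (B.Hs s) :=
  NormedAddCommGroup.induced (B.Hs s) (lp (fun _ : ℕ => ℝ) 2) (toSeq B s) (toSeq_injective B s)

instance : NormedSpace ℝ (B.Hs s) := NormedSpace.induced ℝ (B.Hs s) _ (toSeq B s)

theorem norm_toSeq (w : B.Hs s) : ‖toSeq B s w‖ = ‖w‖ := rfl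

theorem hasSum_inner_toSeq (v w : B.Hs s) :
    HasSum (fun k => B.eigval k ^ (s : ℝ) * B.coeff (incl B s v) k * B.coeff (incl B s w) k)
      (inner ℝ (toSeq B s v) (toSeq B s w)) := by
  have H := lp.hasSum_inner (𝕜 := ℝ) (toSeq B s v) (toSeq B s w)
  have e : (fun k => inner ℝ (toSeq B s v k) (toSeq B s w k)) = fun k =>
      B.eigval k ^ (s : ℝ) * B.coeff (incl B s v) k * B.coeff (incl B s w) k := by
    funext k
    have h : B.eigval k ^ (s : ℝ) =
        B.eigval k ^ ((s : ℝ) / 2) * B.eigval k ^ ((s : ℝ) / 2) := by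
      rw [← Real.rpow_add (B.eigval_pos k), add_halves]
    simp only [toSeq_apply, h, RCLike.inner_apply, conj_trivial]
    ring
  rwa [e] at H

theorem norm_sq_eq (w : B.Hs s) :
    ‖w‖ ^ 2 = ∑' k, B.eigval k ^ (s : ℝ) * B.coeff (incl B s w) k ^ 2 := by
  rw [← norm_toSeq, ← real_inner_self_eq_norm_sq, ← (hasSum_inner_toSeq B s w w).tsum_eq]
  simp only [sq, mul_assoc]

/-- The continuous embedding `ℍ^s(Ω) ↪ L²(Ω)`. -/
def toL2 : B.Hs s →L[ℝ] L2 P :=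
  ⟨incl B s, by
    obtain ⟨m, hm, h⟩ := B.exists_le_eigval
    have hms : 0 < m ^ (s : ℝ) := Real.rpow_pos_of_pos hm _
    refine AddMonoidHomClass.continuous_of_bound (incl B s) (√((m ^ (s : ℝ))⁻¹)) fun w => ?_
    have h1 := (B.hasSum_coeff_sq (incl B s w)).mul_left (m ^ (s : ℝ))
    have h2 := hasSum_inner_toSeq B s w w
    have h3 := hasSum_le (fun k => ?_) h1 h2
    · rw [real_inner_self_eq_norm_sq, norm_toSeq] at h3
      refine abs_le_of_sq_le_sq' ?_ (by positivity) |>.2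
      rw [mul_pow, Real.sq_sqrt (by positivity), inv_mul_eq_div, le_div_iff₀ hms]
      linarith
    · rw [sq, mul_assoc]
      exact mul_le_mul_of_nonneg_right (Real.rpow_le_rpow hm.le (h k) s.2)
        (mul_self_nonneg _)⟩

/-- `ℍ^{-s}(Ω)`, the dual of `ℍ^s(Ω)`. -/
abbrev Dual : Type := StrongDual ℝ (B.Hs s)

/-- The embedding `L²(Ω) ↪ ℍ^{-s}(Ω)`, `⟨f, v⟩ = (f, v)_{L²(Ω)}`. -/
def ofL2 : L2 P →L[ℝ] Dual B s :=
  (innerSL ℝ : L2 P →L[ℝ] L2 P →L[ℝ] ℝ).bilinearComp (.id ℝ (L2 P)) (toL2 B s)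

theorem ofL2_apply (f : L2 P) (v : B.Hs s) : ofL2 B s f v = inner ℝ f (toL2 B s v) := rfl

/-- The isometric embedding `toSeq` as a continuous linear map. -/
def toSeqL : B.Hs s →L[ℝ] lp (fun _ : ℕ => ℝ) 2 :=
  ⟨toSeq B s, AddMonoidHomClass.continuous_of_bound (toSeq B s) 1 fun w => by
    rw [norm_toSeq, one_mul]⟩

/-- The spectral fractional power `𝓛^s : ℍ^s(Ω) → ℍ^{-s}(Ω)`, `𝓛^s w = ∑ λ_k^s w_k φ_k`, that is,
`⟨𝓛^s w, v⟩ = ∑ λ_k^s w_k v_k`; see `fracPow_apply`. -/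
def fracPow : B.Hs s →L[ℝ] Dual B s :=
  (innerSL ℝ : lp (fun _ : ℕ => ℝ) 2 →L[ℝ] lp (fun _ : ℕ => ℝ) 2 →L[ℝ] ℝ).bilinearComp
    (toSeqL B s) (toSeqL B s)

theorem fracPow_apply (w v : B.Hs s) : fracPow B s w v =
    ∑' k, B.eigval k ^ (s : ℝ) * B.coeff (toL2 B s w) k * B.coeff (toL2 B s v) k :=
  (hasSum_inner_toSeq B s w v).tsum_eq.symm

end Hs

end Eigenbasis

/-! ### Functions of time -/

/-- Lebesgue measure on `(0, T)`. -/
def timeMeasure (T : ℝ) : Measure ℝ := volume.restrict (Ioo 0 T)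

/-- `w` is the distributional derivative of `u` on `(0, T)`. -/
def HasWeakTimeDeriv {X : Type*} [NormedAddCommGroup X] [NormedSpace ℝ X] (T : ℝ)
    (u w : ℝ → X) : Prop :=
  ∀ φ : ℝ → ℝ, ContDiff ℝ ∞ φ → HasCompactSupport φ → tsupport φ ⊆ Ioo 0 T →
    ∫ t, deriv φ t • u t ∂timeMeasure T = -∫ t, φ t • w t ∂timeMeasure T

/-- `u` has a representative in `C([0, T]; X)` whose value at `0` is `x`. -/
def HasInitialValue {X : Type*} [TopologicalSpace X] (T : ℝ) (u : ℝ → X) (x : X) : Prop :=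
  ∃ v : ℝ → X, ContinuousOn v (Icc 0 T) ∧ u =ᵐ[timeMeasure T] v ∧ v 0 = x

open Eigenbasis.Hs in
/-- `u ∈ L²(0,T;ℍ^s(Ω))`, with `u' = ∂_t u ∈ L²(0,T;L²(Ω))` and
`u'' = ∂_t² u ∈ L²(0,T;ℍ^{-s}(Ω))`, is a weak solution of
`∂_t² u + 𝓛^s u = f`, `u(0) = g`, `∂_t u(0) = h`. The initial values are those of the continuous
representatives `u ∈ C([0,T];L²(Ω))` and `∂_t u ∈ C([0,T];ℍ^{-s}(Ω))`. -/
def IsWeakSolution {P : EllipticOperator n} (B : Eigenbasis P) (s : ℝ≥0) (T : ℝ)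
    (f : Lp (L2 P) 2 (timeMeasure T)) (g : B.Hs s) (h : L2 P)
    (u : Lp (B.Hs s) 2 (timeMeasure T)) : Prop :=
  ∃ (u' : Lp (L2 P) 2 (timeMeasure T)) (u'' : Lp (Dual B s) 2 (timeMeasure T)),
    HasWeakTimeDeriv T (fun t => toL2 B s (u t)) u' ∧
    HasWeakTimeDeriv T (fun t => ofL2 B s (u' t)) u'' ∧
    HasInitialValue T (fun t => toL2 B s (u t)) (toL2 B s g) ∧
    HasInitialValue T (fun t => ofL2 B s (u' t)) (ofL2 B s h) ∧
    ∀ᵐ t ∂timeMeasure T, ∀ v : B.Hs s,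
      u'' t v + fracPow B s (u t) v = ofL2 B s (f t) v

end FracWave

end

/-
The equation decouples along an eigenbasis of `𝓛` into the scalar oscillators
`∂ₜ²a + λ_k^s a = f_k`. For each mode the energy `(∂ₜa)² + λ_k^s a²` is controlled by the data, by
absorbing the work of `f_k` at a time where the energy is maximal; summing over `k` gives the
a priori bound and the convergence of the series built from the Duhamel solutions. Conversely,
testing a weak solution with one eigenfunction and applying the lemma of du Bois-Reymond shows that
each of its coefficients solves the corresponding oscillator problem, hence is determined by the
data.

The eigenbasis comes from the inverse of `𝓛`, which is symmetric, injective and, by Rellich's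
theorem, compact on `L²(Ω)`. Rellich's theorem holds because on `H¹₀(Ω)` the inclusion into `L²(Ω)`
is the norm limit of the finite rank operators that average over the cells of finer and finer grids.
-/

noncomputable section

open scoped Distributions

namespace FracWave

variable {n : ℕ}

/-! ### Test functions -/

section TestFunction

variable {E : Type*} [NormedAddCommGroup E] [NormedSpace ℝ E] {Ω : TopologicalSpace.Opens E}
  {X : Type*} [NormedAddCommGroup X] [NormedSpace ℝ X]

theorem testFunction_eq_zero_of_notMem (φ : 𝓓(Ω, ℝ)) {x : E} (hx : x ∉ Ω) : φ x = 0 :=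
  image_eq_zero_of_notMem_tsupport fun h => hx (φ.tsupport_subset h)

variable [MeasurableSpace E] {μ : Measure E}

theorem setIntegral_testFunction_smul (φ : 𝓓(Ω, ℝ)) (y : E → X) :
    ∫ x in (Ω : Set E), φ x • y x ∂μ = ∫ x, φ x • y x ∂μ :=
  setIntegral_eq_integral_of_forall_compl_eq_zero fun x hx => by
    rw [testFunction_eq_zero_of_notMem φ hx, zero_smul]

variable [BorelSpace E]

theorem integrable_testFunction_smul (φ : 𝓓(Ω, ℝ)) {y : E → X} (hy : Integrable y μ) :
    Integrable (fun x => φ x • y x) μ :=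
  hy.locallyIntegrable.integrable_smul_left_of_hasCompactSupport φ.continuous φ.hasCompactSupport

theorem integral_testFunction_sub_smul {y : E → X} (hy : Integrable y μ)
    (χ η : 𝓓(Ω, ℝ)) (m : ℝ) :
    ∫ x, (χ - m • η) x • y x ∂μ = ∫ x, χ x • y x ∂μ - m • ∫ x, η x • y x ∂μ := by
  have hsmul : Integrable (fun x => m • η x • y x) μ := (integrable_testFunction_smul η hy).smul m
  simp only [sub_apply, smul_apply, smul_eq_mul, sub_smul, mul_smul]
  rw [integral_sub (integrable_testFunction_smul χ hy) hsmul, integral_smul]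

variable [FiniteDimensional ℝ E]

theorem ae_eq_zero_of_forall_testFunction [CompleteSpace X] {f : E → X}
    (hf : IntegrableOn f Ω μ) (h : ∀ φ : 𝓓(Ω, ℝ), ∫ x in (Ω : Set E), φ x • f x ∂μ = 0) :
    f =ᵐ[μ.restrict Ω] 0 := by
  refine (ae_restrict_iff' Ω.isOpen.measurableSet).mpr ?_
  refine Ω.isOpen.ae_eq_zero_of_integral_contDiff_smul_eq_zero hf.locallyIntegrableOn
    fun φ hφ hc hs => ?_
  rw [← h ⟨φ, hφ, hc, hs⟩]
  exact (setIntegral_testFunction_smul (⟨φ, hφ, hc, hs⟩ : 𝓓(Ω, ℝ)) f).symm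

theorem exists_testFunction_integral_eq_one [IsLocallyFiniteMeasure μ] [μ.IsOpenPosMeasure]
    (hΩ : (Ω : Set E).Nonempty) : ∃ η : 𝓓(Ω, ℝ), ∫ x, η x ∂μ = 1 := by
  obtain ⟨x, hx⟩ := hΩ
  obtain ⟨r, hr, hball⟩ := Metric.isOpen_iff.mp Ω.isOpen x hx
  let bump : ContDiffBump x := ⟨r / 4, r / 2, by positivity, by linarith⟩
  refine ⟨⟨bump.normed μ, bump.contDiff_normed, bump.hasCompactSupport_normed, ?_⟩,
    bump.integral_normed⟩
  rw [bump.tsupport_normed_eq]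
  exact (Metric.closedBall_subset_ball (half_lt_self hr)).trans hball

end TestFunction

/-! ### The lemma of du Bois-Reymond -/

section DuBoisReymond

variable {X : Type*} [NormedAddCommGroup X] [NormedSpace ℝ X] {a b : ℝ}

/-- The interval `(a, b)` as a bundled open set, so that `𝓓(openInterval a b, ℝ)` is the space of
real test functions on `(a, b)`. -/
abbrev openInterval (a b : ℝ) : TopologicalSpace.Opens ℝ := ⟨Ioo a b, isOpen_Ioo⟩

theorem exists_subset_Icc_subset_Ioo {K : Set ℝ} (hK : IsCompact K) (hKab : K ⊆ Ioo a b) :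
    ∃ c d, K ⊆ Icc c d ∧ Icc c d ⊆ Ioo a b := by
  rcases K.eq_empty_or_nonempty with rfl | hne
  · exact ⟨1, 0, empty_subset _, by simp⟩
  · obtain ⟨c, hc⟩ := hK.exists_isLeast hne
    obtain ⟨d, hd⟩ := hK.exists_isGreatest hne
    exact ⟨c, d, fun x hx => ⟨hc.2 hx, hd.2 hx⟩, Icc_subset_Ioo (hKab hc.1).1 (hKab hd.1).2⟩

theorem hasDerivAt_setIntegral_Iic [CompleteSpace X] {f : ℝ → X} (hf : Continuous f)
    (hfi : Integrable f) (x : ℝ) : HasDerivAt (fun x => ∫ y in Iic x, f y) (f x) x := by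
  have hsplit : (fun x => ∫ y in Iic x, f y) =
      fun x => (∫ y in Iic (0 : ℝ), f y) + ∫ y in (0 : ℝ)..x, f y := funext fun x => by
    rw [← intervalIntegral.integral_Iic_sub_Iic hfi.integrableOn hfi.integrableOn,
      add_sub_cancel]
  rw [hsplit]
  exact (hf.integral_hasStrictDerivAt 0 x).hasDerivAt.const_add _

theorem exists_testFunction_deriv_eq (χ : 𝓓(openInterval a b, ℝ)) (hχ : ∫ x, χ x = 0) :
    ∃ ψ : 𝓓(openInterval a b, ℝ), deriv ψ = χ := by
  obtain ⟨c, d, hcd, hab⟩ := exists_subset_Icc_subset_Ioo χ.hasCompactSupport χ.tsupport_subset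
  have hzero : ∀ x ∉ Icc c d, χ x = 0 := fun x hx =>
    image_eq_zero_of_notMem_tsupport fun h => hx (hcd h)
  have hderiv := hasDerivAt_setIntegral_Iic χ.continuous
    (χ.continuous.integrable_of_hasCompactSupport χ.hasCompactSupport)
  set ψ : ℝ → ℝ := fun x => ∫ y in Iic x, χ y
  have hψ : deriv ψ = χ := funext fun x => (hderiv x).deriv
  have hψsmooth : ContDiff ℝ ∞ ψ :=
    contDiff_infty_iff_deriv.mpr ⟨fun x => (hderiv x).differentiableAt, hψ ▸ χ.contDiff⟩
  have hψzero : ∀ x ∉ Icc c d, ψ x = 0 := fun x hx => by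
    rcases lt_or_ge x c with hxc | hcx
    · exact setIntegral_eq_zero_of_forall_eq_zero fun y hy =>
        hzero y fun hycd => (hycd.1.trans hy).not_gt hxc
    · have hdx : d < x := lt_of_not_ge fun hxd => hx ⟨hcx, hxd⟩
      rw [← hχ]
      exact setIntegral_eq_integral_of_forall_compl_eq_zero fun y hy =>
        hzero y fun hycd => hy (hycd.2.trans hdx.le)
  have hψsupp : tsupport ψ ⊆ Icc c d :=
    closure_minimal (Function.support_subset_iff'.mpr hψzero) isClosed_Icc
  exact ⟨⟨ψ, hψsmooth, isCompact_Icc.of_isClosed_subset (isClosed_tsupport _) hψsupp,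
    hψsupp.trans hab⟩, hψ⟩

/- With `η` a test function of mass one, `χ - (∫ χ) η` is the derivative of a test function for
every test function `χ`, so that `∫ χ y = (∫ χ) ∫ η y`, that is, `y` is the constant `∫ η y`. -/
theorem exists_ae_eq_const_of_integral_deriv_smul_eq_zero [CompleteSpace X] {y : ℝ → X}
    (hy : IntegrableOn y (Ioo a b))
    (h : ∀ φ : 𝓓(openInterval a b, ℝ), ∫ t in Ioo a b, deriv φ t • y t = 0) :
    ∃ c, y =ᵐ[volume.restrict (Ioo a b)] fun _ => c := by
  rcases (Ioo a b).eq_empty_or_nonempty with hempty | hne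
  · exact ⟨0, by simp [hempty, EventuallyEq]⟩
  obtain ⟨η, hη⟩ :=
    exists_testFunction_integral_eq_one (Ω := openInterval a b) (μ := volume) hne
  set c := ∫ t in Ioo a b, η t • y t
  refine ⟨c, ?_⟩
  have hyc : IntegrableOn (fun t => y t - c) (openInterval a b) :=
    hy.sub (integrableOn_const (by simp))
  suffices hzero : ∀ χ : 𝓓(openInterval a b, ℝ), ∫ t in Ioo a b, χ t • (y t - c) = 0 by
    filter_upwards [ae_eq_zero_of_forall_testFunction hyc hzero] with t ht
    exact sub_eq_zero.mp ht
  intro χ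
  have hφi : ∀ φ : 𝓓(openInterval a b, ℝ), Integrable φ := fun φ =>
    φ.continuous.integrable_of_hasCompactSupport φ.hasCompactSupport
  obtain ⟨ψ, hψ⟩ := exists_testFunction_deriv_eq (χ - (∫ x, χ x) • η) (by
    simp only [sub_apply, smul_apply, smul_eq_mul]
    rw [integral_sub (hφi χ) ((hφi η).const_mul _), integral_const_mul, hη, mul_one, sub_self])
  have hconst : ∫ t in Ioo a b, χ t • c = (∫ x, χ x) • c := by
    rw [integral_smul_const]
    congr 1
    simpa using setIntegral_testFunction_smul (μ := volume) χ fun _ => (1 : ℝ)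
  calc ∫ t in Ioo a b, χ t • (y t - c)
      = (∫ t in Ioo a b, χ t • y t) - (∫ x, χ x) • c := by
        simp only [smul_sub]
        rw [← hconst, integral_sub (integrable_testFunction_smul χ hy)
          ((hφi χ).integrableOn.smul_const c)]
    _ = ∫ t in Ioo a b, deriv ψ t • y t := by
        rw [hψ, integral_testFunction_sub_smul hy]
    _ = 0 := h ψ

end DuBoisReymond

/-! ### Weak time derivatives -/

section TimeMeasure

variable {X : Type*} [NormedAddCommGroup X] {T : ℝ}

instance (T : ℝ) : IsFiniteMeasure (timeMeasure T) := by
  unfold timeMeasure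
  infer_instance

theorem ae_timeMeasure_of_forall {p : ℝ → Prop} (h : ∀ t ∈ Icc 0 T, p t) :
    ∀ᵐ t ∂timeMeasure T, p t :=
  ae_restrict_of_forall_mem measurableSet_Ioo fun t ht => h t (Ioo_subset_Icc_self ht)

theorem integral_timeMeasure [NormedSpace ℝ X] (hT : 0 ≤ T) (f : ℝ → X) :
    ∫ t, f t ∂timeMeasure T = ∫ t in (0 : ℝ)..T, f t := by
  rw [intervalIntegral.integral_of_le hT, integral_Ioc_eq_integral_Ioo, timeMeasure]

theorem intervalIntegrable_of_timeMeasure {f : ℝ → X} (hf : Integrable f (timeMeasure T)) {t : ℝ}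
    (ht : t ∈ Icc 0 T) : IntervalIntegrable f volume 0 t :=
  (intervalIntegrable_iff_integrableOn_Ioo_of_le ht.1).mpr
    (IntegrableOn.mono_set hf (Ioo_subset_Ioo_right ht.2))

theorem uIcc_zero_subset_Icc {t : ℝ} (ht : t ∈ Icc 0 T) : uIcc 0 t ⊆ Icc 0 T := by
  rw [uIcc_of_le ht.1]
  exact Icc_subset_Icc_right ht.2

theorem continuousOn_primitive_timeMeasure [NormedSpace ℝ X] {f : ℝ → X}
    (hf : Integrable f (timeMeasure T)) :
    ContinuousOn (fun t => ∫ τ in (0 : ℝ)..t, f τ) (Icc 0 T) := by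
  rcases lt_or_ge T 0 with hT | hT
  · rw [Icc_eq_empty hT.not_ge]
    exact continuousOn_empty _
  · rw [← uIcc_of_le hT]
    exact intervalIntegral.continuousOn_primitive_interval'
      (intervalIntegrable_of_timeMeasure hf (right_mem_Icc.mpr hT)) left_mem_uIcc

theorem memLp_timeMeasure_of_continuousOn {u : ℝ → X} (hu : ContinuousOn u (Icc 0 T))
    (p : ℝ≥0∞) : MemLp u p (timeMeasure T) := by
  obtain ⟨K, hK⟩ := isCompact_Icc.exists_bound_of_continuousOn hu
  exact MemLp.of_bound ((hu.mono Ioo_subset_Icc_self).aestronglyMeasurable measurableSet_Ioo) K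
    (ae_timeMeasure_of_forall hK)

theorem integrable_timeMeasure_of_continuousOn {u : ℝ → X} (hu : ContinuousOn u (Icc 0 T)) :
    Integrable u (timeMeasure T) :=
  memLp_one_iff_integrable.mp (memLp_timeMeasure_of_continuousOn hu 1)

theorem eqOn_Icc_of_ae_eq_timeMeasure (hT : 0 < T) {u v : ℝ → X} (hu : ContinuousOn u (Icc 0 T))
    (hv : ContinuousOn v (Icc 0 T)) (h : u =ᵐ[timeMeasure T] v) : EqOn u v (Icc 0 T) :=
  have hIoo : EqOn u v (Ioo 0 T) := Measure.eqOn_open_of_ae_eq h isOpen_Ioo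
    (hu.mono Ioo_subset_Icc_self) (hv.mono Ioo_subset_Icc_self)
  hIoo.of_subset_closure hu hv Ioo_subset_Icc_self (closure_Ioo hT.ne).ge

end TimeMeasure

section WeakDeriv

variable {X Y : Type*} [NormedAddCommGroup X] [NormedSpace ℝ X] [NormedAddCommGroup Y]
  [NormedSpace ℝ Y] {T : ℝ} {u w : ℝ → X}

theorem integrable_deriv_testFunction_smul {Ω : TopologicalSpace.Opens ℝ} {μ : Measure ℝ}
    (φ : 𝓓(Ω, ℝ)) (hu : Integrable u μ) : Integrable (fun t => deriv φ t • u t) μ :=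
  hu.locallyIntegrable.integrable_smul_left_of_hasCompactSupport
    (φ.contDiff.continuous_deriv (by simp)) φ.hasCompactSupport.deriv

theorem hasWeakTimeDeriv_iff : HasWeakTimeDeriv T u w ↔ ∀ φ : 𝓓(openInterval 0 T, ℝ),
    ∫ t, deriv φ t • u t ∂timeMeasure T = -∫ t, φ t • w t ∂timeMeasure T :=
  ⟨fun h φ => h φ φ.contDiff φ.hasCompactSupport φ.tsupport_subset,
    fun h φ hφ hc hs => h ⟨φ, hφ, hc, hs⟩⟩

theorem HasWeakTimeDeriv.congr {u' w' : ℝ → X} (h : HasWeakTimeDeriv T u w)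
    (hu : u =ᵐ[timeMeasure T] u') (hw : w =ᵐ[timeMeasure T] w') : HasWeakTimeDeriv T u' w' := by
  refine hasWeakTimeDeriv_iff.mpr fun φ => ?_
  rw [integral_congr_ae ((EventuallyEq.refl _ (deriv φ)).smul hu.symm),
    integral_congr_ae ((EventuallyEq.refl _ φ).smul hw.symm)]
  exact hasWeakTimeDeriv_iff.mp h φ

theorem HasWeakTimeDeriv.map [CompleteSpace X] [CompleteSpace Y] (h : HasWeakTimeDeriv T u w)
    (hu : Integrable u (timeMeasure T)) (hw : Integrable w (timeMeasure T)) (L : X →L[ℝ] Y) :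
    HasWeakTimeDeriv T (fun t => L (u t)) (fun t => L (w t)) := by
  refine hasWeakTimeDeriv_iff.mpr fun φ => ?_
  simp only [← map_smul]
  rw [L.integral_comp_comm (integrable_deriv_testFunction_smul φ hu),
    L.integral_comp_comm (integrable_testFunction_smul φ hw), hasWeakTimeDeriv_iff.mp h φ, map_neg]

theorem hasWeakTimeDeriv_of_forall_map [CompleteSpace X] {ι : Type*}
    (hu : Integrable u (timeMeasure T)) (hw : Integrable w (timeMeasure T)) (L : ι → X →L[ℝ] ℝ)
    (hL : ∀ x x' : X, (∀ i, L i x = L i x') → x = x')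
    (h : ∀ i, HasWeakTimeDeriv T (fun t => L i (u t)) (fun t => L i (w t))) :
    HasWeakTimeDeriv T u w := by
  refine hasWeakTimeDeriv_iff.mpr fun φ => hL _ _ fun i => ?_
  rw [map_neg, ← (L i).integral_comp_comm (integrable_deriv_testFunction_smul φ hu),
    ← (L i).integral_comp_comm (integrable_testFunction_smul φ hw)]
  simpa only [map_smul] using hasWeakTimeDeriv_iff.mp (h i) φ

theorem HasWeakTimeDeriv.sub {u' w' : ℝ → X} (h : HasWeakTimeDeriv T u w)
    (h' : HasWeakTimeDeriv T u' w') (hu : Integrable u (timeMeasure T))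
    (hw : Integrable w (timeMeasure T)) (hu' : Integrable u' (timeMeasure T))
    (hw' : Integrable w' (timeMeasure T)) :
    HasWeakTimeDeriv T (fun t => u t - u' t) (fun t => w t - w' t) := by
  refine hasWeakTimeDeriv_iff.mpr fun φ => ?_
  simp only [smul_sub]
  rw [integral_sub (integrable_deriv_testFunction_smul φ hu)
      (integrable_deriv_testFunction_smul φ hu'), integral_sub (integrable_testFunction_smul φ hw)
      (integrable_testFunction_smul φ hw'), hasWeakTimeDeriv_iff.mp h, hasWeakTimeDeriv_iff.mp h',
    neg_sub_neg, neg_sub]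

theorem HasWeakTimeDeriv.unique [CompleteSpace X] {w' : ℝ → X} (h : HasWeakTimeDeriv T u w)
    (h' : HasWeakTimeDeriv T u w') (hw : Integrable w (timeMeasure T))
    (hw' : Integrable w' (timeMeasure T)) : w =ᵐ[timeMeasure T] w' := by
  have hzero : ∀ φ : 𝓓(openInterval 0 T, ℝ), ∫ t, φ t • (w t - w' t) ∂timeMeasure T = 0 := by
    intro φ
    simp only [smul_sub]
    rw [integral_sub (integrable_testFunction_smul φ hw) (integrable_testFunction_smul φ hw'),
      sub_eq_zero, ← neg_inj, ← hasWeakTimeDeriv_iff.mp h φ, hasWeakTimeDeriv_iff.mp h' φ]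
  filter_upwards [ae_eq_zero_of_forall_testFunction (Ω := openInterval 0 T) (hw.sub hw') hzero]
    with t ht
  exact sub_eq_zero.mp ht

theorem HasWeakTimeDeriv.exists_ae_eq_const [CompleteSpace X] (h : HasWeakTimeDeriv T u 0)
    (hu : Integrable u (timeMeasure T)) : ∃ c, u =ᵐ[timeMeasure T] fun _ => c :=
  exists_ae_eq_const_of_integral_deriv_smul_eq_zero hu fun φ => by
    simpa [timeMeasure] using hasWeakTimeDeriv_iff.mp h φ

theorem integral_mul_primitive_add_primitive_mul {q r : ℝ → ℝ} {a b : ℝ}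
    (hq : IntervalIntegrable q volume a b) (hr : IntervalIntegrable r volume a b) (q₀ r₀ : ℝ) :
    ∫ x in a..b, (q x * (r₀ + ∫ y in a..x, r y) + (q₀ + ∫ y in a..x, q y) * r x) =
      (q₀ + ∫ y in a..b, q y) * (r₀ + ∫ y in a..b, r y) - q₀ * r₀ := by
  have hconst : ∀ c : ℝ, AbsolutelyContinuousOnInterval (fun _ => c) a b := fun c =>
    (LipschitzWith.const c).lipschitzOnWith.absolutelyContinuousOnInterval
  have hQ : AbsolutelyContinuousOnInterval (fun x => q₀ + ∫ y in a..x, q y) a b :=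
    (hconst q₀).add (hq.absolutelyContinuousOnInterval_intervalIntegral left_mem_uIcc)
  have hR : AbsolutelyContinuousOnInterval (fun x => r₀ + ∫ y in a..x, r y) a b :=
    (hconst r₀).add (hr.absolutelyContinuousOnInterval_intervalIntegral left_mem_uIcc)
  have hparts := hQ.integral_deriv_mul_eq_sub hR
  simp only [intervalIntegral.integral_same, add_zero] at hparts
  rw [← hparts]
  refine intervalIntegral.integral_congr_ae ?_
  filter_upwards [hq.ae_hasDerivAt_integral, hr.ae_hasDerivAt_integral] with x hqx hrx hx
  have hx' := uIoc_subset_uIcc hx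
  rw [((hqx hx' a left_mem_uIcc).const_add q₀).deriv,
    ((hrx hx' a left_mem_uIcc).const_add r₀).deriv]

theorem hasWeakTimeDeriv_const_add_primitive_real (hT : 0 ≤ T) {q : ℝ → ℝ}
    (hq : Integrable q (timeMeasure T)) (c : ℝ) :
    HasWeakTimeDeriv T (fun t => c + ∫ τ in (0 : ℝ)..t, q τ) q := by
  refine hasWeakTimeDeriv_iff.mpr fun φ => ?_
  have hφdiff : Differentiable ℝ φ := φ.contDiff.differentiable (by simp)
  have hφderiv : Continuous (deriv φ) := φ.contDiff.continuous_deriv (by simp)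
  have hφ0 : φ 0 = 0 := testFunction_eq_zero_of_notMem φ fun h => lt_irrefl _ h.1
  have hφT : φ T = 0 := testFunction_eq_zero_of_notMem φ fun h => lt_irrefl _ h.2
  have hφ : ∀ t, ∫ τ in (0 : ℝ)..t, deriv φ τ = φ t := fun t => by
    rw [intervalIntegral.integral_deriv_eq_sub (fun x _ => hφdiff x)
      (hφderiv.intervalIntegrable _ _), hφ0, sub_zero]
  have hprim : ContinuousOn (fun t => c + ∫ τ in (0 : ℝ)..t, q τ) (Icc 0 T) :=
    continuousOn_const.add (continuousOn_primitive_timeMeasure hq)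
  have hq' := intervalIntegrable_of_timeMeasure hq (right_mem_Icc.mpr hT)
  have hparts := integral_mul_primitive_add_primitive_mul (hφderiv.intervalIntegrable 0 T) hq' 0 c
  simp only [hφ, hφT, zero_add, ← smul_eq_mul, zero_smul, sub_zero] at hparts
  rw [← integral_timeMeasure hT, integral_add
    (integrable_deriv_testFunction_smul φ
      (integrable_timeMeasure_of_continuousOn hprim))
    (integrable_testFunction_smul φ hq)] at hparts
  exact eq_neg_of_add_eq_zero_left hparts

theorem hasWeakTimeDeriv_const_add_primitive [CompleteSpace X] (hT : 0 ≤ T)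
    (hw : Integrable w (timeMeasure T)) (x : X) :
    HasWeakTimeDeriv T (fun t => x + ∫ τ in (0 : ℝ)..t, w τ) w := by
  refine hasWeakTimeDeriv_of_forall_map (integrable_timeMeasure_of_continuousOn
      (continuousOn_const.add (continuousOn_primitive_timeMeasure hw))) hw
    (fun ℓ : StrongDual ℝ X => ℓ) (fun x x' h => SeparatingDual.eq_iff_forall_dual_eq.mpr h)
    fun ℓ => ?_
  refine (hasWeakTimeDeriv_const_add_primitive_real hT (ℓ.integrable_comp hw) (ℓ x)).congr
    (ae_timeMeasure_of_forall fun t ht => ?_) EventuallyEq.rfl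
  simp only [map_add, add_right_inj]
  exact ℓ.intervalIntegral_comp_comm (intervalIntegrable_of_timeMeasure hw ht)

theorem HasWeakTimeDeriv.eq_add_integral [CompleteSpace X] (h : HasWeakTimeDeriv T u w)
    (hT : 0 < T) (hw : Integrable w (timeMeasure T)) {v : ℝ → X} (hv : ContinuousOn v (Icc 0 T))
    (huv : u =ᵐ[timeMeasure T] v) {t : ℝ} (ht : t ∈ Icc 0 T) :
    v t = v 0 + ∫ τ in (0 : ℝ)..t, w τ := by
  have hprim : ContinuousOn (fun t => v 0 + ∫ τ in (0 : ℝ)..t, w τ) (Icc 0 T) :=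
    continuousOn_const.add (continuousOn_primitive_timeMeasure hw)
  have hdiff : HasWeakTimeDeriv T (fun t => v t - (v 0 + ∫ τ in (0 : ℝ)..t, w τ)) 0 := by
    simpa only [sub_self] using! (h.congr huv EventuallyEq.rfl).sub
      (hasWeakTimeDeriv_const_add_primitive hT.le hw (v 0))
      (integrable_timeMeasure_of_continuousOn hv) hw
      (integrable_timeMeasure_of_continuousOn hprim) hw
  obtain ⟨c, hc⟩ :=
    hdiff.exists_ae_eq_const (integrable_timeMeasure_of_continuousOn (hv.sub hprim))
  have hconst := eqOn_Icc_of_ae_eq_timeMeasure hT (hv.sub hprim) continuousOn_const hc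
  have hc0 : 0 = c := by simpa using hconst (left_mem_Icc.mpr hT.le)
  exact sub_eq_zero.mp ((hconst ht).trans hc0.symm)

end WeakDeriv

/-! ### The harmonic oscillator -/

/-- The harmonic oscillator `v'' + μ v = f`, `v(0) = g`, `v'(0) = h` on `[0, T]`, with velocity
`w = v'`. The equation is stated in integrated form since `f` is only assumed integrable. -/
structure IsOscillation (T μ : ℝ) (f : ℝ → ℝ) (g h : ℝ) (v w : ℝ → ℝ) : Prop where
  continuousOn_fst : ContinuousOn v (Icc 0 T)
  continuousOn_snd : ContinuousOn w (Icc 0 T)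
  fst_eq : ∀ t ∈ Icc 0 T, v t = g + ∫ τ in (0 : ℝ)..t, w τ
  snd_eq : ∀ t ∈ Icc 0 T, w t = h + ∫ τ in (0 : ℝ)..t, (f τ - μ * v τ)

theorem exists_hasDerivAt_duhamel {F : ℝ → ℝ} (hF : Continuous F) (ν g : ℝ) :
    ∃ v p : ℝ → ℝ, v 0 = g ∧ p 0 = 0 ∧ (∀ t, HasDerivAt v (F t + p t) t) ∧
      ∀ t, HasDerivAt p (-(ν ^ 2 * v t)) t := by
  set C : ℝ → ℝ := fun t => ∫ τ in (0 : ℝ)..t, Real.cos (ν * τ) * F τ with hC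
  set S : ℝ → ℝ := fun t => ∫ τ in (0 : ℝ)..t, Real.sin (ν * τ) * F τ with hS
  have dC : ∀ t, HasDerivAt C (Real.cos (ν * t) * F t) t := fun t =>
    (Continuous.integral_hasStrictDerivAt (by fun_prop) 0 t).hasDerivAt
  have dS : ∀ t, HasDerivAt S (Real.sin (ν * t) * F t) t := fun t =>
    (Continuous.integral_hasStrictDerivAt (by fun_prop) 0 t).hasDerivAt
  have dcos : ∀ t, HasDerivAt (fun t => Real.cos (ν * t)) (-Real.sin (ν * t) * ν) t := fun t => by
    simpa using ((hasDerivAt_id t).const_mul ν).cos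
  have dsin : ∀ t, HasDerivAt (fun t => Real.sin (ν * t)) (Real.cos (ν * t) * ν) t := fun t => by
    simpa using ((hasDerivAt_id t).const_mul ν).sin
  refine ⟨fun t => Real.cos (ν * t) * (g + C t) + Real.sin (ν * t) * S t,
    fun t => ν * (Real.cos (ν * t) * S t - Real.sin (ν * t) * (g + C t)),
    by simp [hC], by simp [hS], fun t => ?_, fun t => ?_⟩
  · refine (((dcos t).mul ((dC t).const_add g)).add ((dsin t).mul (dS t))).congr_deriv ?_
    linear_combination F t * Real.sin_sq_add_cos_sq (ν * t)
  · refine ((((dcos t).mul (dS t)).sub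
      ((dsin t).mul ((dC t).const_add g))).const_mul ν).congr_deriv ?_
    ring

theorem integral_mul_le_of_sq_le {T E r : ℝ} {f w : ℝ → ℝ} (hT : 0 < T)
    (hf : MemLp f 2 (timeMeasure T)) (hw : ContinuousOn w (Icc 0 T)) (hr : r ∈ Icc 0 T)
    (hE : ∀ t ∈ Icc 0 T, w t ^ 2 ≤ E) :
    ∫ τ in (0 : ℝ)..r, f τ * w τ ≤ T * ∫ τ, f τ ^ 2 ∂timeMeasure T + E / 4 := by
  have hf2 := hf.integrable_sq
  have hfw : Integrable (fun τ => f τ * w τ) (timeMeasure T) :=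
    hf.integrable_mul (memLp_timeMeasure_of_continuousOn hw 2)
  have hf2r := intervalIntegrable_of_timeMeasure hf2 hr
  have young : ∀ τ ∈ Icc 0 r, f τ * w τ ≤ T * f τ ^ 2 + E / (4 * T) := fun τ hτ => by
    have hsq : T * f τ ^ 2 + w τ ^ 2 / (4 * T) - f τ * w τ =
        (2 * T * f τ - w τ) ^ 2 / (4 * T) := by
      field_simp
      ring
    have hpos : 0 ≤ (2 * T * f τ - w τ) ^ 2 / (4 * T) := by positivity
    have hwE : w τ ^ 2 / (4 * T) ≤ E / (4 * T) := by
      gcongr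
      exact hE τ ⟨hτ.1, hτ.2.trans hr.2⟩
    linarith
  have hE0 : 0 ≤ E := (sq_nonneg (w r)).trans (hE r hr)
  calc ∫ τ in (0 : ℝ)..r, f τ * w τ
      ≤ ∫ τ in (0 : ℝ)..r, (T * f τ ^ 2 + E / (4 * T)) :=
        intervalIntegral.integral_mono_on hr.1
          (intervalIntegrable_of_timeMeasure hfw hr)
          ((hf2r.const_mul T).add intervalIntegrable_const) young
    _ = T * (∫ τ in (0 : ℝ)..r, f τ ^ 2) + r * (E / (4 * T)) := by
        rw [intervalIntegral.integral_add (hf2r.const_mul T) intervalIntegrable_const,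
          intervalIntegral.integral_const_mul, intervalIntegral.integral_const, smul_eq_mul,
          sub_zero]
    _ ≤ T * (∫ τ in (0 : ℝ)..T, f τ ^ 2) + T * (E / (4 * T)) := by
        gcongr
        · exact intervalIntegral.integral_mono_interval le_rfl hr.1 hr.2
            (Eventually.of_forall fun x => sq_nonneg _)
            (intervalIntegrable_of_timeMeasure hf2 (right_mem_Icc.mpr hT.le))
        · exact hr.2
    _ = T * ∫ τ, f τ ^ 2 ∂timeMeasure T + E / 4 := by
        rw [integral_timeMeasure hT.le]
        field_simp

namespace IsOscillation

variable {T μ g h : ℝ} {f v w : ℝ → ℝ}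

theorem congr_ae (H : IsOscillation T μ f g h v w) {f' : ℝ → ℝ}
    (hf : f =ᵐ[timeMeasure T] f') : IsOscillation T μ f' g h v w where
  continuousOn_fst := H.continuousOn_fst
  continuousOn_snd := H.continuousOn_snd
  fst_eq := H.fst_eq
  snd_eq t ht := by
    have hft : f =ᵐ[timeMeasure t] f' :=
      ae_restrict_of_ae_restrict_of_subset (Ioo_subset_Ioo_right ht.2) hf
    rw [H.snd_eq t ht, ← integral_timeMeasure ht.1, ← integral_timeMeasure ht.1]
    congr 1
    exact integral_congr_ae (hft.sub EventuallyEq.rfl)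

theorem congr_on (H : IsOscillation T μ f g h v w) {v' w' : ℝ → ℝ}
    (hv : EqOn v v' (Icc 0 T)) (hw : EqOn w w' (Icc 0 T)) : IsOscillation T μ f g h v' w' where
  continuousOn_fst := H.continuousOn_fst.congr hv.symm
  continuousOn_snd := H.continuousOn_snd.congr hw.symm
  fst_eq t ht := by
    rw [← hv ht, H.fst_eq t ht,
      intervalIntegral.integral_congr fun x hx => hw (uIcc_zero_subset_Icc ht hx)]
  snd_eq t ht := by
    rw [← hw ht, H.snd_eq t ht]
    congr 1
    exact intervalIntegral.integral_congr fun x hx => by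
      simp only [hv (uIcc_zero_subset_Icc ht hx)]

theorem exists_of_integrable (T : ℝ) (hμ : 0 ≤ μ) (hf : Integrable f) (g h : ℝ) :
    ∃ v w, IsOscillation T μ f g h v w := by
  set F : ℝ → ℝ := fun t => h + ∫ τ in (0 : ℝ)..t, f τ
  have hF : Continuous F := continuous_const.add
    (intervalIntegral.continuous_primitive (fun a b => hf.intervalIntegrable) 0)
  obtain ⟨v, p, hv0, hp0, dv, dp⟩ := exists_hasDerivAt_duhamel hF √μ g
  rw [Real.sq_sqrt hμ] at dp
  have hv : Continuous v := continuous_iff_continuousAt.mpr fun t => (dv t).continuousAt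
  have hp : Continuous p := continuous_iff_continuousAt.mpr fun t => (dp t).continuousAt
  refine ⟨v, fun t => F t + p t, hv.continuousOn, (hF.add hp).continuousOn, fun t _ => ?_,
    fun t _ => ?_⟩
  · rw [intervalIntegral.integral_eq_sub_of_hasDerivAt (fun x _ => dv x)
      ((hF.add hp).intervalIntegrable _ _), hv0, add_sub_cancel]
  · have hpt := intervalIntegral.integral_eq_sub_of_hasDerivAt (a := 0) (b := t) (fun x _ => dp x)
      ((hv.const_mul μ).neg.intervalIntegrable _ _)
    rw [intervalIntegral.integral_neg, hp0, sub_zero] at hpt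
    rw [intervalIntegral.integral_sub hf.intervalIntegrable
      ((hv.const_mul μ).intervalIntegrable _ _), ← hpt]
    ring

theorem exists_of_integrable_timeMeasure (hμ : 0 ≤ μ) (hf : Integrable f (timeMeasure T))
    (g h : ℝ) : ∃ v w, IsOscillation T μ f g h v w := by
  obtain ⟨v, w, H⟩ := exists_of_integrable T hμ
    ((integrable_indicator_iff measurableSet_Ioo).mpr hf) g h
  exact ⟨v, w, H.congr_ae (indicator_ae_eq_restrict measurableSet_Ioo)⟩

theorem integrable_snd_integrand (H : IsOscillation T μ f g h v w)
    (hf : Integrable f (timeMeasure T)) : Integrable (fun t => f t - μ * v t) (timeMeasure T) :=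
  hf.sub ((integrable_timeMeasure_of_continuousOn H.continuousOn_fst).const_mul μ)

theorem hasWeakTimeDeriv_fst (H : IsOscillation T μ f g h v w) (hT : 0 ≤ T) :
    HasWeakTimeDeriv T v w := by
  have hw := integrable_timeMeasure_of_continuousOn H.continuousOn_snd
  refine (hasWeakTimeDeriv_const_add_primitive hT hw g).congr
    (ae_timeMeasure_of_forall fun t ht => (H.fst_eq t ht).symm) EventuallyEq.rfl

theorem hasWeakTimeDeriv_snd (H : IsOscillation T μ f g h v w) (hT : 0 ≤ T)
    (hf : Integrable f (timeMeasure T)) : HasWeakTimeDeriv T w (fun t => f t - μ * v t) :=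
  (hasWeakTimeDeriv_const_add_primitive hT (H.integrable_snd_integrand hf) h).congr
    (ae_timeMeasure_of_forall fun t ht => (H.snd_eq t ht).symm) EventuallyEq.rfl

theorem of_hasWeakTimeDeriv (hT : 0 < T) {y z : ℝ → ℝ} (hf : Integrable f (timeMeasure T))
    (hyz : HasWeakTimeDeriv T y z) (hz : HasWeakTimeDeriv T z fun t => f t - μ * y t)
    (hv : ContinuousOn v (Icc 0 T)) (hw : ContinuousOn w (Icc 0 T))
    (hyv : y =ᵐ[timeMeasure T] v) (hzw : z =ᵐ[timeMeasure T] w) :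
    IsOscillation T μ f (v 0) (w 0) v w where
  continuousOn_fst := hv
  continuousOn_snd := hw
  fst_eq _ := (hyz.congr EventuallyEq.rfl hzw).eq_add_integral hT
    (integrable_timeMeasure_of_continuousOn hw) hv hyv
  snd_eq _ := by
    have hderiv : HasWeakTimeDeriv T z fun t => f t - μ * v t := by
      refine hz.congr EventuallyEq.rfl ?_
      filter_upwards [hyv] with t ht
      rw [ht]
    exact hderiv.eq_add_integral hT
      (hf.sub ((integrable_timeMeasure_of_continuousOn hv).const_mul μ)) hw hzw

theorem energy_eq (H : IsOscillation T μ f g h v w) (hf : Integrable f (timeMeasure T)) {t : ℝ}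
    (ht : t ∈ Icc 0 T) :
    w t ^ 2 + μ * v t ^ 2 = h ^ 2 + μ * g ^ 2 + 2 * ∫ τ in (0 : ℝ)..t, f τ * w τ := by
  have hsub := uIcc_zero_subset_Icc ht
  have hv := H.continuousOn_fst.mono hsub
  have hw := H.continuousOn_snd.mono hsub
  have hvw : IntervalIntegrable (fun τ => 2 * (w τ * v τ)) volume 0 t :=
    (hw.mul hv).intervalIntegrable.const_mul 2
  have hfw : IntervalIntegrable (fun τ => f τ * w τ) volume 0 t :=
    (intervalIntegrable_of_timeMeasure hf ht).mul_continuousOn hw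
  have potential : ∫ τ in (0 : ℝ)..t, 2 * (w τ * v τ) = v t ^ 2 - g ^ 2 := by
    have hparts := integral_mul_primitive_add_primitive_mul hw.intervalIntegrable
      hw.intervalIntegrable g g
    rw [← H.fst_eq t ht, ← sq, ← sq] at hparts
    rw [← hparts]
    exact intervalIntegral.integral_congr fun τ hτ => by
      simp only [← H.fst_eq τ (hsub hτ)]
      ring
  have kinetic : ∫ τ in (0 : ℝ)..t, (2 * (f τ * w τ) - μ * (2 * (w τ * v τ))) =
      w t ^ 2 - h ^ 2 := by
    have hq := intervalIntegrable_of_timeMeasure (H.integrable_snd_integrand hf) ht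
    have hparts := integral_mul_primitive_add_primitive_mul hq hq h h
    rw [← H.snd_eq t ht, ← sq, ← sq] at hparts
    rw [← hparts]
    exact intervalIntegral.integral_congr fun τ hτ => by
      simp only [← H.snd_eq τ (hsub hτ)]
      ring
  rw [intervalIntegral.integral_sub (hfw.const_mul 2) (hvw.const_mul μ),
    intervalIntegral.integral_const_mul, intervalIntegral.integral_const_mul, potential] at kinetic
  linarith

/- At a time of maximal energy `E`, the work of the force is at most `T ∫ f² + E / 4`, and the
second term is absorbed on the left of the energy identity. -/
theorem energy_le (H : IsOscillation T μ f g h v w) (hT : 0 < T) (hμ : 0 ≤ μ)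
    (hf : MemLp f 2 (timeMeasure T)) {t : ℝ} (ht : t ∈ Icc 0 T) :
    w t ^ 2 + μ * v t ^ 2 ≤
      2 * (h ^ 2 + μ * g ^ 2) + 4 * T * ∫ τ, f τ ^ 2 ∂timeMeasure T := by
  obtain ⟨r, hr, hmax⟩ := isCompact_Icc.exists_isMaxOn ⟨t, ht⟩
    ((H.continuousOn_snd.pow 2).add ((H.continuousOn_fst.pow 2).const_mul μ) :
      ContinuousOn (fun t => w t ^ 2 + μ * v t ^ 2) (Icc 0 T))
  have hmax' : ∀ τ ∈ Icc 0 T, w τ ^ 2 + μ * v τ ^ 2 ≤ w r ^ 2 + μ * v r ^ 2 := fun τ hτ => hmax hτ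
  have hw : ∀ τ ∈ Icc 0 T, w τ ^ 2 ≤ w r ^ 2 + μ * v r ^ 2 := fun τ hτ =>
    (le_add_of_nonneg_right (mul_nonneg hμ (sq_nonneg _))).trans (hmax' τ hτ)
  have hwork := integral_mul_le_of_sq_le hT hf H.continuousOn_snd hr hw
  linarith [hmax' t ht, H.energy_eq (hf.integrable (by norm_num)) hr]

theorem sub (H : IsOscillation T μ f g h v w) {f' v' w' : ℝ → ℝ} {g' h' : ℝ}
    (H' : IsOscillation T μ f' g' h' v' w') (hf : Integrable f (timeMeasure T))
    (hf' : Integrable f' (timeMeasure T)) :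
    IsOscillation T μ (fun t => f t - f' t) (g - g') (h - h') (fun t => v t - v' t)
      (fun t => w t - w' t) where
  continuousOn_fst := H.continuousOn_fst.sub H'.continuousOn_fst
  continuousOn_snd := H.continuousOn_snd.sub H'.continuousOn_snd
  fst_eq t ht := by
    rw [H.fst_eq t ht, H'.fst_eq t ht, intervalIntegral.integral_sub
      (H.continuousOn_snd.mono (uIcc_zero_subset_Icc ht)).intervalIntegrable
      (H'.continuousOn_snd.mono (uIcc_zero_subset_Icc ht)).intervalIntegrable]
    ring
  snd_eq t ht := by
    rw [H.snd_eq t ht, H'.snd_eq t ht, add_sub_add_comm, ← intervalIntegral.integral_sub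
      (intervalIntegrable_of_timeMeasure (H.integrable_snd_integrand hf) ht)
      (intervalIntegrable_of_timeMeasure (H'.integrable_snd_integrand hf') ht)]
    congr 1
    exact intervalIntegral.integral_congr fun x _ => by ring

theorem snd_unique (H : IsOscillation T μ f g h v w) {v' w' : ℝ → ℝ}
    (H' : IsOscillation T μ f g h v' w') (hμ : 0 ≤ μ) (hf : Integrable f (timeMeasure T)) :
    EqOn w w' (Icc 0 T) := fun t ht => by
  have henergy := (H.sub H' hf hf).energy_eq (hf.sub hf) ht
  simp only [sub_self, zero_mul, intervalIntegral.integral_zero] at henergy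
  have hv := mul_nonneg hμ (sq_nonneg (v t - v' t))
  have hw : (w t - w' t) ^ 2 = 0 := by nlinarith [sq_nonneg (w t - w' t)]
  exact sub_eq_zero.mp (pow_eq_zero_iff two_ne_zero |>.mp hw)

theorem fst_unique (H : IsOscillation T μ f g h v w) {v' w' : ℝ → ℝ}
    (H' : IsOscillation T μ f g h v' w') (hμ : 0 ≤ μ) (hf : Integrable f (timeMeasure T)) :
    EqOn v v' (Icc 0 T) := fun t ht => by
  rw [H.fst_eq t ht, H'.fst_eq t ht, intervalIntegral.integral_congr fun x hx =>
    H.snd_unique H' hμ hf (uIcc_zero_subset_Icc ht hx)]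

end IsOscillation

/-! ### Square summable sequences -/

section SquareSummable

variable {ι : Type*} {G : ι → Type*} [∀ i, NormedAddCommGroup (G i)]

theorem hasSum_norm_sq_lp_two (a : lp G 2) : HasSum (fun i => ‖a i‖ ^ 2) (‖a‖ ^ 2) := by
  simpa using lp.hasSum_norm (p := 2) (by simp) a

theorem memℓp_two_of_summable_norm_sq {a : ∀ i, G i} (h : Summable fun i => ‖a i‖ ^ 2) :
    Memℓp a 2 :=
  memℓp_gen (h.congr fun i => by simp)

variable {X : Type*} [TopologicalSpace X] {S : Set X} {M : ι → ℝ}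

theorem continuousOn_lp_two_of_dominated {A : X → lp G 2} (hM : Summable M)
    (hA : ∀ i, ContinuousOn (fun x => A x i) S) (hAM : ∀ x ∈ S, ∀ i, ‖A x i‖ ^ 2 ≤ M i) :
    ContinuousOn A S := by
  intro x₀ hx₀
  have hdom : ∀ x ∈ S, ∀ i, ‖A x i - A x₀ i‖ ^ 2 ≤ 4 * M i := fun x hx i => by
    have htri := pow_le_pow_left₀ (norm_nonneg _) (norm_sub_le (A x i) (A x₀ i)) 2
    linarith [hAM x hx i, hAM x₀ hx₀ i, add_sq_le (a := ‖A x i‖) (b := ‖A x₀ i‖)]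
  have hcoord : ∀ i, Tendsto (fun x => ‖A x i - A x₀ i‖ ^ 2) (𝓝[S] x₀) (𝓝 0) := fun i => by
    simpa using (((hA i x₀ hx₀).tendsto.sub_const (A x₀ i)).norm).pow 2
  have hsq : Tendsto (fun x => ‖A x - A x₀‖ ^ 2) (𝓝[S] x₀) (𝓝 0) := by
    have hlim := tendsto_tsum_of_dominated_convergence (hM.mul_left 4) hcoord <| by
      filter_upwards [self_mem_nhdsWithin] with x hx i
      rw [Real.norm_of_nonneg (by positivity)]
      exact hdom x hx i
    simpa only [tsum_zero, ← (hasSum_norm_sq_lp_two _).tsum_eq] using! hlim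
  rw [ContinuousWithinAt, tendsto_iff_norm_sub_tendsto_zero]
  simpa [Real.sqrt_sq (norm_nonneg _)] using hsq.sqrt

theorem exists_continuousOn_lp_two {a : ∀ i, X → G i} {m : ℝ} (hM : HasSum M m)
    (ha : ∀ i, ContinuousOn (a i) S) (haM : ∀ x ∈ S, ∀ i, ‖a i x‖ ^ 2 ≤ M i) :
    ∃ A : X → lp G 2, ContinuousOn A S ∧ (∀ x ∈ S, ∀ i, A x i = a i x) ∧
      ∀ x ∈ S, ‖A x‖ ^ 2 ≤ m := by
  classical
  have hsummable : ∀ x ∈ S, Summable fun i => ‖a i x‖ ^ 2 := fun x hx =>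
    Summable.of_nonneg_of_le (fun i => by positivity) (haM x hx) hM.summable
  let A : X → lp G 2 := fun x =>
    if hx : x ∈ S then ⟨fun i => a i x, memℓp_two_of_summable_norm_sq (hsummable x hx)⟩ else 0
  have hA : ∀ x ∈ S, ∀ i, A x i = a i x := fun x hx i => by
    simp only [A, dif_pos hx]
  have hAM : ∀ x ∈ S, ∀ i, ‖A x i‖ ^ 2 ≤ M i := fun x hx i => by
    rw [hA x hx]
    exact haM x hx i
  exact ⟨A, continuousOn_lp_two_of_dominated hM.summable
    (fun i => (ha i).congr fun x hx => hA x hx i) hAM, hA,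
    fun x hx => hasSum_le (hAM x hx) (hasSum_norm_sq_lp_two (A x)) hM⟩

end SquareSummable

theorem hasSum_integral_inner_sq {ι α E : Type*} [Countable ι] [NormedAddCommGroup E]
    [InnerProductSpace ℝ E] {_ : MeasurableSpace α} {μ : Measure α} (b : HilbertBasis ι ℝ E)
    (f : Lp E 2 μ) : HasSum (fun i => ∫ x, inner ℝ (b i) (f x) ^ 2 ∂μ) (‖f‖ ^ 2) := by
  have hsum : ∀ x, HasSum (fun i => inner ℝ (b i) (f x) ^ 2) (‖f x‖ ^ 2) := fun x => by
    simpa [sq, real_inner_comm, real_inner_self_eq_norm_mul_norm]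
      using b.hasSum_inner_mul_inner (f x) (f x)
  rw [norm_sq_eq_integral]
  refine hasSum_integral_of_dominated_convergence (fun i x => inner ℝ (b i) (f x) ^ 2)
    (fun i => ((innerSL ℝ (b i)).comp_memLp f).integrable_sq.aestronglyMeasurable)
    (fun i => Eventually.of_forall fun x => ?_)
    (Eventually.of_forall fun x => (hsum x).summable) ?_ (Eventually.of_forall hsum)
  · rw [Real.norm_of_nonneg (sq_nonneg _)]
  · simp only [(hsum _).tsum_eq]
    exact (Lp.memLp f).integrable_norm_pow (by simp)

/-! ### The spaces `ℍ^s(Ω)` -/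

namespace Eigenbasis

variable {P : EllipticOperator n} (B : Eigenbasis P)

theorem eq_of_coeff_eq {v w : L2 P} (h : ∀ k, B.coeff v k = B.coeff w k) : v = w := by
  apply B.basis.repr.injective
  ext k
  rw [B.basis.repr_apply_apply, B.basis.repr_apply_apply]
  exact h k

theorem coeff_repr_symm (a : lp (fun _ : ℕ => ℝ) 2) (k : ℕ) :
    B.coeff (B.basis.repr.symm a) k = a k := by
  rw [coeff, ← B.basis.repr_apply_apply, LinearIsometryEquiv.apply_symm_apply]

theorem coeff_basis (j k : ℕ) : B.coeff (B.basis k) j = if j = k then 1 else 0 :=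
  orthonormal_iff_ite.mp B.basis.orthonormal j k

theorem memLp_coeff {α : Type*} {_ : MeasurableSpace α} {μ : Measure α} {p : ℝ≥0∞} {f : α → L2 P}
    (hf : MemLp f p μ) (k : ℕ) : MemLp (fun x => B.coeff (f x) k) p μ :=
  (innerSL ℝ (B.basis k)).comp_memLp' hf

theorem eigval_rpow_half_sq (s : ℝ) (k : ℕ) : (B.eigval k ^ (s / 2)) ^ 2 = B.eigval k ^ s := by
  rw [← Real.rpow_mul_natCast (B.eigval_pos k).le, Nat.cast_two, div_mul_cancel₀ s two_ne_zero]

namespace Hs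

variable (s : ℝ≥0)

theorem memℓp_div_eigval_rpow (a : lp (fun _ : ℕ => ℝ) 2) :
    Memℓp (fun k => a k / B.eigval k ^ ((s : ℝ) / 2)) 2 := by
  obtain ⟨m, hm, hle⟩ := B.exists_le_eigval
  have hmpos : 0 < m ^ ((s : ℝ) / 2) := Real.rpow_pos_of_pos hm _
  refine memℓp_two_of_summable_norm_sq (Summable.of_nonneg_of_le (fun k => sq_nonneg _)
    (fun k => ?_) ((hasSum_norm_sq_lp_two a).summable.div_const ((m ^ ((s : ℝ) / 2)) ^ 2)))
  have hmk := Real.rpow_le_rpow hm.le (hle k) (z := (s : ℝ) / 2) (by positivity)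
  rw [norm_div, div_pow, Real.norm_of_nonneg (hmpos.le.trans hmk)]
  gcongr

theorem toSeq_surjective : Function.Surjective (toSeq B s) := by
  intro a
  let b : lp (fun _ : ℕ => ℝ) 2 := ⟨_, memℓp_div_eigval_rpow B s a⟩
  have hb : ∀ k, B.eigval k ^ ((s : ℝ) / 2) * b k = a k := fun k =>
    mul_div_cancel₀ _ (Real.rpow_pos_of_pos (B.eigval_pos k) _).ne'
  have hmem : B.basis.repr.symm b ∈ B.HsSub s := by
    refine (hasSum_norm_sq_lp_two a).summable.congr fun k => ?_
    rw [coeff_repr_symm, ← eigval_rpow_half_sq, ← mul_pow, hb, Real.norm_eq_abs, sq_abs]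
  refine ⟨⟨B.basis.repr.symm b, hmem⟩, ?_⟩
  ext k
  exact (congrArg _ (B.coeff_repr_symm b k)).trans (hb k)

/-- The isometric isomorphism `w ↦ (λ_k^{s/2} w_k)_k` of `ℍ^s(Ω)` onto `ℓ²`, through which
functions with values in `ℍ^s(Ω)` are built from their coefficients. -/
def toSeqEquiv : B.Hs s ≃ₗᵢ[ℝ] lp (fun _ : ℕ => ℝ) 2 :=
  LinearIsometryEquiv.ofSurjective ⟨toSeq B s, norm_toSeq B s⟩ (toSeq_surjective B s)

theorem toSeqEquiv_apply (w : B.Hs s) (k : ℕ) :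
    toSeqEquiv B s w k = B.eigval k ^ ((s : ℝ) / 2) * B.coeff (toL2 B s w) k := rfl

theorem hasSum_norm_sq (w : B.Hs s) :
    HasSum (fun k => B.eigval k ^ (s : ℝ) * B.coeff (toL2 B s w) k ^ 2) (‖w‖ ^ 2) := by
  simpa [toSeqEquiv_apply, mul_pow, eigval_rpow_half_sq]
    using hasSum_norm_sq_lp_two (toSeqEquiv B s w)

/-- The eigenfunction `φ_k` as an element of `ℍ^s(Ω)`. -/
def eigenfun (k : ℕ) : B.Hs s :=
  ⟨B.basis k, summable_of_ne_finset_zero (s := {k}) fun j hj => by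
    rw [coeff_basis, if_neg (by simpa using hj)]
    ring⟩

theorem toL2_eigenfun (k : ℕ) : toL2 B s (eigenfun B s k) = B.basis k := rfl

theorem toSeqEquiv_eigenfun (k : ℕ) :
    toSeqEquiv B s (eigenfun B s k) = lp.single 2 k (B.eigval k ^ ((s : ℝ) / 2)) := by
  ext j
  rw [toSeqEquiv_apply, toL2_eigenfun, coeff_basis, lp.coeFn_single]
  rcases eq_or_ne j k with rfl | hjk
  · simp
  · simp [hjk]

theorem hasSum_eigenfun (v : B.Hs s) :
    HasSum (fun k => B.coeff (toL2 B s v) k • eigenfun B s k) v := by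
  rw [← (toSeqEquiv B s).toContinuousLinearEquiv.hasSum']
  convert! lp.hasSum_single (p := 2) (by simp) (toSeqEquiv B s v) using 1
  funext k
  rw [map_smul, LinearIsometryEquiv.coe_toContinuousLinearEquiv, toSeqEquiv_eigenfun,
    ← lp.single_smul, toSeqEquiv_apply, smul_eq_mul, mul_comm]

theorem dual_ext {F G : Dual B s} (h : ∀ k, F (eigenfun B s k) = G (eigenfun B s k)) : F = G := by
  ext v
  refine ((hasSum_eigenfun B s v).mapL F).unique ?_
  simpa only [map_smul, h] using (hasSum_eigenfun B s v).mapL G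

theorem ofL2_eigenfun (f : L2 P) (k : ℕ) : ofL2 B s f (eigenfun B s k) = B.coeff f k := by
  rw [ofL2_apply, toL2_eigenfun, real_inner_comm, coeff]

theorem fracPow_eigenfun (w : B.Hs s) (k : ℕ) :
    fracPow B s w (eigenfun B s k) = B.eigval k ^ (s : ℝ) * B.coeff (toL2 B s w) k := by
  rw [fracPow_apply, tsum_eq_single k fun j hj => by
    rw [toL2_eigenfun, coeff_basis, if_neg hj, mul_zero], toL2_eigenfun, coeff_basis, if_pos rfl,
    mul_one]

variable {s} {X : Type*} [TopologicalSpace X] {S : Set X} {a : ℕ → X → ℝ} {M : ℕ → ℝ} {m : ℝ}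

theorem exists_continuousOn_coeff_eq (hM : HasSum M m) (ha : ∀ k, ContinuousOn (a k) S)
    (haM : ∀ x ∈ S, ∀ k, B.eigval k ^ (s : ℝ) * a k x ^ 2 ≤ M k) :
    ∃ U : X → B.Hs s, ContinuousOn U S ∧ (∀ x ∈ S, ∀ k, B.coeff (toL2 B s (U x)) k = a k x) ∧
      ∀ x ∈ S, ‖U x‖ ^ 2 ≤ m := by
  obtain ⟨A, hAcont, hA, hAm⟩ := exists_continuousOn_lp_two hM
    (a := fun k x => B.eigval k ^ ((s : ℝ) / 2) * a k x) (fun k => (ha k).const_mul _)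
    (fun x hx k => by
      rw [Real.norm_eq_abs, sq_abs, mul_pow, eigval_rpow_half_sq]
      exact haM x hx k)
  refine ⟨fun x => (toSeqEquiv B s).symm (A x),
    (toSeqEquiv B s).symm.continuous.comp_continuousOn hAcont, fun x hx k => ?_, fun x hx => ?_⟩
  · have hcoeff := toSeqEquiv_apply B s ((toSeqEquiv B s).symm (A x)) k
    rw [LinearIsometryEquiv.apply_symm_apply, hA x hx] at hcoeff
    exact (mul_left_cancel₀ (Real.rpow_pos_of_pos (B.eigval_pos k) _).ne' hcoeff).symm
  · rw [LinearIsometryEquiv.norm_map]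
    exact hAm x hx

end Hs

theorem exists_continuousOn_coeff_eq {X : Type*} [TopologicalSpace X] {S : Set X} {a : ℕ → X → ℝ}
    {M : ℕ → ℝ} {m : ℝ} (hM : HasSum M m) (ha : ∀ k, ContinuousOn (a k) S)
    (haM : ∀ x ∈ S, ∀ k, a k x ^ 2 ≤ M k) :
    ∃ W : X → L2 P, ContinuousOn W S ∧ (∀ x ∈ S, ∀ k, B.coeff (W x) k = a k x) ∧
      ∀ x ∈ S, ‖W x‖ ^ 2 ≤ m := by
  obtain ⟨A, hAcont, hA, hAm⟩ := exists_continuousOn_lp_two hM ha (fun x hx k => by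
    rw [Real.norm_eq_abs, sq_abs]
    exact haM x hx k)
  refine ⟨fun x => B.basis.repr.symm (A x),
    B.basis.repr.symm.continuous.comp_continuousOn hAcont, fun x hx k => ?_, fun x hx => ?_⟩
  · rw [coeff_repr_symm, hA x hx]
  · rw [LinearIsometryEquiv.norm_map]
    exact hAm x hx

end Eigenbasis

/-! ### The fractional wave equation -/

theorem eLpNorm_top_timeMeasure_le {X : Type*} [NormedAddCommGroup X] {T K : ℝ} {u v : ℝ → X}
    (huv : u =ᵐ[timeMeasure T] v) (hv : ∀ t ∈ Icc 0 T, ‖v t‖ ≤ K) :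
    eLpNorm u ∞ (timeMeasure T) ≤ ENNReal.ofReal K := by
  rw [eLpNorm_congr_ae huv, eLpNorm_exponent_top]
  exact eLpNormEssSup_le_of_ae_bound (ae_timeMeasure_of_forall hv)

theorem two_mul_add_sq_add_four_mul_sq_le_sq {r : ℝ} (hr : 0 ≤ r) {a b c : ℝ} (ha : 0 ≤ a)
    (hb : 0 ≤ b) (hc : 0 ≤ c) :
    2 * (c ^ 2 + b ^ 2) + 4 * r ^ 2 * a ^ 2 ≤ (2 * (1 + r) * (a + b + c)) ^ 2 := by
  have hsum : a ^ 2 + b ^ 2 + c ^ 2 ≤ (a + b + c) ^ 2 := by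
    nlinarith [mul_nonneg ha hb, mul_nonneg ha hc, mul_nonneg hb hc]
  have hr2 : 1 + r ^ 2 ≤ (1 + r) ^ 2 := by nlinarith
  calc 2 * (c ^ 2 + b ^ 2) + 4 * r ^ 2 * a ^ 2
      ≤ 4 * ((1 + r ^ 2) * (a ^ 2 + b ^ 2 + c ^ 2)) := by
        nlinarith [sq_nonneg a, sq_nonneg b, sq_nonneg c, mul_nonneg (sq_nonneg r) (sq_nonneg b),
          mul_nonneg (sq_nonneg r) (sq_nonneg c)]
    _ ≤ 4 * ((1 + r) ^ 2 * (a + b + c) ^ 2) := by gcongr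
    _ = (2 * (1 + r) * (a + b + c)) ^ 2 := by ring

section Wave

open Eigenbasis Eigenbasis.Hs

variable {P : EllipticOperator n} {B : Eigenbasis P} {s : ℝ≥0} {T : ℝ}

/-- `U` and its velocity `W` are continuous on `[0, T]` and their coefficients solve the scalar
equations `u_k'' + λ_k^s u_k = f_k`, `u_k(0) = g_k`, `u_k'(0) = h_k` into which the fractional wave
equation decouples. -/
structure IsModalSolution (B : Eigenbasis P) (s : ℝ≥0) (T : ℝ) (f : ℝ → L2 P) (g : B.Hs s)
    (h : L2 P) (U : ℝ → B.Hs s) (W : ℝ → L2 P) : Prop where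
  continuousOn_fst : ContinuousOn U (Icc 0 T)
  continuousOn_snd : ContinuousOn W (Icc 0 T)
  isOscillation : ∀ k, IsOscillation T (B.eigval k ^ (s : ℝ)) (fun t => B.coeff (f t) k)
    (B.coeff (toL2 B s g) k) (B.coeff h k) (fun t => B.coeff (toL2 B s (U t)) k)
    (fun t => B.coeff (W t) k)

theorem exists_isModalSolution (hT : 0 < T) (f : Lp (L2 P) 2 (timeMeasure T)) (g : B.Hs s)
    (h : L2 P) : ∃ U W, IsModalSolution B s T f g h U W ∧
      (∀ t ∈ Icc 0 T, ‖U t‖ ^ 2 ≤ 2 * (‖h‖ ^ 2 + ‖g‖ ^ 2) + 4 * T * ‖f‖ ^ 2) ∧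
      ∀ t ∈ Icc 0 T, ‖W t‖ ^ 2 ≤ 2 * (‖h‖ ^ 2 + ‖g‖ ^ 2) + 4 * T * ‖f‖ ^ 2 := by
  have hpow : ∀ k, 0 ≤ B.eigval k ^ (s : ℝ) := fun k => Real.rpow_nonneg (B.eigval_pos k).le _
  have hf := B.memLp_coeff (Lp.memLp f)
  choose v w H using fun k => IsOscillation.exists_of_integrable_timeMeasure (hpow k)
    ((hf k).integrable one_le_two) (B.coeff (toL2 B s g) k) (B.coeff h k)
  have henergy := fun k t (ht : t ∈ Icc 0 T) => (H k).energy_le hT (hpow k) (hf k) ht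
  have hsum := (((B.hasSum_coeff_sq h).add (hasSum_norm_sq B s g)).mul_left 2).add
    ((hasSum_integral_inner_sq B.basis f).mul_left (4 * T))
  obtain ⟨U, hUcont, hU, hUle⟩ := Hs.exists_continuousOn_coeff_eq B (s := s) hsum
    (fun k => (H k).continuousOn_fst)
    fun t ht k => (le_add_of_nonneg_left (sq_nonneg (w k t))).trans (henergy k t ht)
  obtain ⟨W, hWcont, hW, hWle⟩ := B.exists_continuousOn_coeff_eq hsum
    (fun k => (H k).continuousOn_snd) fun t ht k =>
      (le_add_of_nonneg_right (mul_nonneg (hpow k) (sq_nonneg (v k t)))).trans (henergy k t ht)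
  exact ⟨U, W, ⟨hUcont, hWcont, fun k => (H k).congr_on (fun t ht => (hU t ht k).symm)
    fun t ht => (hW t ht k).symm⟩, hUle, hWle⟩

namespace IsModalSolution

variable {f : Lp (L2 P) 2 (timeMeasure T)} {g : B.Hs s} {h : L2 P} {U : ℝ → B.Hs s} {W : ℝ → L2 P}

theorem hasWeakTimeDeriv_fst (H : IsModalSolution B s T f g h U W) (hT : 0 ≤ T) :
    HasWeakTimeDeriv T (fun t => toL2 B s (U t)) W :=
  hasWeakTimeDeriv_of_forall_map
    (integrable_timeMeasure_of_continuousOn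
      ((toL2 B s).continuous.comp_continuousOn H.continuousOn_fst))
    (integrable_timeMeasure_of_continuousOn H.continuousOn_snd)
    (fun k => innerSL ℝ (B.basis k)) (fun _ _ hx => B.eq_of_coeff_eq hx)
    fun k => (H.isOscillation k).hasWeakTimeDeriv_fst hT

theorem hasWeakTimeDeriv_snd (H : IsModalSolution B s T f g h U W) (hT : 0 ≤ T) :
    HasWeakTimeDeriv T (fun t => ofL2 B s (W t)) fun t => ofL2 B s (f t) - fracPow B s (U t) := by
  have hf := (Lp.memLp f).integrable one_le_two
  have hU := integrable_timeMeasure_of_continuousOn H.continuousOn_fst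
  have hW := integrable_timeMeasure_of_continuousOn H.continuousOn_snd
  refine hasWeakTimeDeriv_of_forall_map ((ofL2 B s).integrable_comp hW)
    (((ofL2 B s).integrable_comp hf).sub ((fracPow B s).integrable_comp hU))
    (fun k => ContinuousLinearMap.apply ℝ ℝ (eigenfun B s k)) (fun _ _ hx => dual_ext B s hx)
    fun k => ?_
  simpa only [ContinuousLinearMap.apply_apply, sub_apply, ofL2_eigenfun, fracPow_eigenfun] using
    (H.isOscillation k).hasWeakTimeDeriv_snd hT
      ((B.memLp_coeff (Lp.memLp f) k).integrable one_le_two)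

theorem fst_zero (H : IsModalSolution B s T f g h U W) (hT : 0 ≤ T) :
    toL2 B s (U 0) = toL2 B s g :=
  B.eq_of_coeff_eq fun k => by
    simpa using (H.isOscillation k).fst_eq 0 (left_mem_Icc.mpr hT)

theorem snd_zero (H : IsModalSolution B s T f g h U W) (hT : 0 ≤ T) : W 0 = h :=
  B.eq_of_coeff_eq fun k => by
    simpa using (H.isOscillation k).snd_eq 0 (left_mem_Icc.mpr hT)

theorem isWeakSolution (H : IsModalSolution B s T f g h U W) (hT : 0 ≤ T)
    {u : Lp (B.Hs s) 2 (timeMeasure T)} (hu : u =ᵐ[timeMeasure T] U) :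
    IsWeakSolution B s T f g h u := by
  have hW := memLp_timeMeasure_of_continuousOn H.continuousOn_snd 2
  have hU'' : MemLp (fun t => ofL2 B s (f t) - fracPow B s (U t)) 2 (timeMeasure T) :=
    ((ofL2 B s).comp_memLp' (Lp.memLp f)).sub
      ((fracPow B s).comp_memLp' (memLp_timeMeasure_of_continuousOn H.continuousOn_fst 2))
  have huL2 := hu.fun_comp (toL2 B s)
  have hWdual := hW.coeFn_toLp.fun_comp (ofL2 B s)
  refine ⟨hW.toLp W, hU''.toLp _,
    (H.hasWeakTimeDeriv_fst hT).congr huL2.symm hW.coeFn_toLp.symm,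
    (H.hasWeakTimeDeriv_snd hT).congr hWdual.symm hU''.coeFn_toLp.symm,
    ⟨_, (toL2 B s).continuous.comp_continuousOn H.continuousOn_fst, huL2, H.fst_zero hT⟩,
    ⟨_, (ofL2 B s).continuous.comp_continuousOn H.continuousOn_snd, hWdual,
      congrArg (ofL2 B s) (H.snd_zero hT)⟩, ?_⟩
  filter_upwards [hu, hU''.coeFn_toLp] with t hut hu''t v
  rw [hut, hu''t, sub_apply, sub_add_cancel]

end IsModalSolution

namespace IsWeakSolution

variable {f : Lp (L2 P) 2 (timeMeasure T)} {g : B.Hs s} {h : L2 P}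
  {u : Lp (B.Hs s) 2 (timeMeasure T)} {U : ℝ → B.Hs s} {W : ℝ → L2 P}

theorem exists_isOscillation (hu : IsWeakSolution B s T f g h u) (hT : 0 < T) (k : ℕ) :
    ∃ v w, (fun t => B.coeff (toL2 B s (u t)) k) =ᵐ[timeMeasure T] v ∧
      IsOscillation T (B.eigval k ^ (s : ℝ)) (fun t => B.coeff (f t) k) (B.coeff (toL2 B s g) k)
        (B.coeff h k) v w := by
  obtain ⟨u', u'', huu', hu'u'', ⟨V, hVcont, huV, hV0⟩, ⟨Z, hZcont, hu'Z, hZ0⟩, heq⟩ := hu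
  have iu := (toL2 B s).integrable_comp ((Lp.memLp u).integrable one_le_two)
  have iu' := (Lp.memLp u').integrable one_le_two
  have iu'' := (Lp.memLp u'').integrable one_le_two
  have hZk : (fun t => B.coeff (u' t) k) =ᵐ[timeMeasure T] fun t => Z t (eigenfun B s k) := by
    filter_upwards [hu'Z] with t ht
    rw [← ofL2_eigenfun, ht]
  have hderiv : HasWeakTimeDeriv T (fun t => B.coeff (toL2 B s (u t)) k)
      fun t => B.coeff (u' t) k := huu'.map iu iu' (innerSL ℝ (B.basis k))
  have hderiv' : HasWeakTimeDeriv T (fun t => B.coeff (u' t) k)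
      fun t => B.coeff (f t) k - B.eigval k ^ (s : ℝ) * B.coeff (toL2 B s (u t)) k := by
    have hmode := hu'u''.map ((ofL2 B s).integrable_comp iu') iu''
      (ContinuousLinearMap.apply ℝ ℝ (eigenfun B s k))
    simp only [ContinuousLinearMap.apply_apply, ofL2_eigenfun] at hmode
    refine hmode.congr EventuallyEq.rfl ?_
    filter_upwards [heq] with t ht
    rw [eq_sub_iff_add_eq, ← fracPow_eigenfun, ht, ofL2_eigenfun]
  have hosc := IsOscillation.of_hasWeakTimeDeriv hT
    ((B.memLp_coeff (Lp.memLp f) k).integrable one_le_two) hderiv hderiv'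
    ((innerSL ℝ (B.basis k)).continuous.comp_continuousOn hVcont)
    ((ContinuousLinearMap.apply ℝ ℝ (eigenfun B s k)).continuous.comp_continuousOn hZcont)
    (huV.fun_comp fun x => B.coeff x k) hZk
  refine ⟨fun t => B.coeff (V t) k, fun t => Z t (eigenfun B s k),
    huV.fun_comp fun x => B.coeff x k, ?_⟩
  rw [← hV0, ← ofL2_eigenfun B s h, ← hZ0]
  exact hosc

theorem ae_eq (hu : IsWeakSolution B s T f g h u) (hT : 0 < T)
    (H : IsModalSolution B s T f g h U W) : u =ᵐ[timeMeasure T] U := by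
  have hmode : ∀ k, ∀ᵐ t ∂timeMeasure T,
      B.coeff (toL2 B s (u t)) k = B.coeff (toL2 B s (U t)) k := fun k => by
    obtain ⟨v, w, huv, hosc⟩ := hu.exists_isOscillation hT k
    exact huv.trans (ae_timeMeasure_of_forall (hosc.fst_unique (H.isOscillation k)
      (Real.rpow_nonneg (B.eigval_pos k).le _)
      ((B.memLp_coeff (Lp.memLp f) k).integrable one_le_two)))
  filter_upwards [ae_all_iff.mpr hmode] with t ht
  exact incl_injective B s (B.eq_of_coeff_eq ht)

theorem ae_eq_weakTimeDeriv (hu : IsWeakSolution B s T f g h u) (hT : 0 < T)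
    (H : IsModalSolution B s T f g h U W) {u' : Lp (L2 P) 2 (timeMeasure T)}
    (hu' : HasWeakTimeDeriv T (fun t => toL2 B s (u t)) u') : u' =ᵐ[timeMeasure T] W :=
  hu'.unique ((H.hasWeakTimeDeriv_fst hT.le).congr
    ((hu.ae_eq hT H).fun_comp (toL2 B s)).symm EventuallyEq.rfl)
    ((Lp.memLp u').integrable one_le_two)
    (integrable_timeMeasure_of_continuousOn H.continuousOn_snd)

theorem eLpNorm_top_add_eLpNorm_top_le (hu : IsWeakSolution B s T f g h u) (hT : 0 < T)
    {u' : Lp (L2 P) 2 (timeMeasure T)} (hu' : HasWeakTimeDeriv T (fun t => toL2 B s (u t)) u') :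
    eLpNorm u ∞ (timeMeasure T) + eLpNorm u' ∞ (timeMeasure T) ≤
      ENNReal.ofReal (4 * (1 + √T) * (‖f‖ + ‖g‖ + ‖h‖)) := by
  obtain ⟨U, W, H, hU, hW⟩ := exists_isModalSolution hT f g h
  set K := 2 * (1 + √T) * (‖f‖ + ‖g‖ + ‖h‖)
  have hK : 0 ≤ K := by positivity
  have hdata : 2 * (‖h‖ ^ 2 + ‖g‖ ^ 2) + 4 * T * ‖f‖ ^ 2 ≤ K ^ 2 := by
    simpa only [Real.sq_sqrt hT.le] using two_mul_add_sq_add_four_mul_sq_le_sq (Real.sqrt_nonneg T)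
      (norm_nonneg f) (norm_nonneg g) (norm_nonneg h)
  calc eLpNorm u ∞ (timeMeasure T) + eLpNorm u' ∞ (timeMeasure T)
      ≤ ENNReal.ofReal K + ENNReal.ofReal K := add_le_add
        (eLpNorm_top_timeMeasure_le (hu.ae_eq hT H) fun t ht =>
          le_of_sq_le_sq ((hU t ht).trans hdata) hK)
        (eLpNorm_top_timeMeasure_le (hu.ae_eq_weakTimeDeriv hT H hu') fun t ht =>
          le_of_sq_le_sq ((hW t ht).trans hdata) hK)
    _ = ENNReal.ofReal (4 * (1 + √T) * (‖f‖ + ‖g‖ + ‖h‖)) := by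
        rw [← ENNReal.ofReal_add hK hK]
        congr 1
        ring

end IsWeakSolution

theorem existsUnique_isWeakSolution (hT : 0 < T) (f : Lp (L2 P) 2 (timeMeasure T)) (g : B.Hs s)
    (h : L2 P) : ∃! u : Lp (B.Hs s) 2 (timeMeasure T), IsWeakSolution B s T f g h u := by
  obtain ⟨U, W, H, -, -⟩ := exists_isModalSolution hT f g h
  have hU := memLp_timeMeasure_of_continuousOn H.continuousOn_fst 2
  exact ⟨hU.toLp U, H.isWeakSolution hT.le hU.coeFn_toLp,
    fun u hu => Lp.ext ((hu.ae_eq hT H).trans hU.coeFn_toLp.symm)⟩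

end Wave

/-! ### Compactness of `H¹₀(Ω) ↪ L²(Ω)` -/

section Average

variable {α F : Type*} [MeasurableSpace α] {μ : Measure α} [NormedAddCommGroup F]

theorem eLpNorm_two_sq (f : α → F) : eLpNorm f 2 μ ^ 2 = ∫⁻ x, ‖f x‖ₑ ^ 2 ∂μ := by
  simpa using eLpNorm_nnreal_pow_eq_lintegral (f := f) (μ := μ) (two_ne_zero (α := ℝ≥0))

theorem enorm_sq_eq_lintegral (w : Lp F 2 μ) : ‖w‖ₑ ^ 2 = ∫⁻ x, ‖w x‖ₑ ^ 2 ∂μ := by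
  rw [Lp.enorm_def, eLpNorm_two_sq]

variable [NormedSpace ℝ F]

theorem enorm_integral_sq_le {f : α → F} (hf : AEStronglyMeasurable f μ) :
    ‖∫ x, f x ∂μ‖ₑ ^ 2 ≤ μ univ * ∫⁻ x, ‖f x‖ₑ ^ 2 ∂μ := by
  have hexp : 1 / ENNReal.toReal 1 - 1 / ENNReal.toReal 2 = (2⁻¹ : ℝ) := by norm_num
  have hHolder := eLpNorm_le_eLpNorm_mul_rpow_measure_univ one_le_two hf
  rw [eLpNorm_one_eq_lintegral_enorm, hexp] at hHolder
  calc ‖∫ x, f x ∂μ‖ₑ ^ 2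
      ≤ (eLpNorm f 2 μ * μ univ ^ (2⁻¹ : ℝ)) ^ 2 := by
        gcongr
        exact (enorm_integral_le_lintegral_enorm f).trans hHolder
    _ = μ univ * ∫⁻ x, ‖f x‖ₑ ^ 2 ∂μ := by
        rw [mul_pow, eLpNorm_two_sq, ← ENNReal.rpow_natCast (_ ^ _), ← ENNReal.rpow_mul, mul_comm]
        norm_num

theorem enorm_average_sq_le {f : α → F} (hf : AEStronglyMeasurable f μ) :
    ‖⨍ x, f x ∂μ‖ₑ ^ 2 ≤ ⨍⁻ x, ‖f x‖ₑ ^ 2 ∂μ := by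
  refine (enorm_integral_sq_le (hf.smul_measure _)).trans (mul_le_of_le_one_left' ?_)
  exact ENNReal.inv_mul_le_one _

theorem enorm_sub_setAverage_sq_le [CompleteSpace F] {f : α → F} {s : Set α}
    (hf : IntegrableOn f s μ) (h0 : μ s ≠ 0) (htop : μ s ≠ ⊤) (c : F) :
    ‖c - ⨍ y in s, f y ∂μ‖ₑ ^ 2 ≤ (μ s)⁻¹ * ∫⁻ y in s, ‖c - f y‖ₑ ^ 2 ∂μ := by
  have hdev : c - ⨍ y in s, f y ∂μ = ⨍ y in s, (c - f y) ∂μ := by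
    have hreal : μ.real s ≠ 0 := measureReal_ne_zero_iff htop |>.mpr h0
    have hconst : IntegrableOn (fun _ => c) s μ := integrableOn_const htop
    rw [setAverage_eq, setAverage_eq, integral_sub hconst hf, setIntegral_const,
      smul_sub, inv_smul_smul₀ hreal]
  rw [hdev, ← ENNReal.div_eq_inv_mul, ← setLAverage_eq]
  exact enorm_average_sq_le (aestronglyMeasurable_const.sub hf.aestronglyMeasurable)

end Average

section Translation

variable {E F : Type*} [NormedAddCommGroup E] [NormedSpace ℝ E] [NormedAddCommGroup F]
  [NormedSpace ℝ F] [CompleteSpace F] {φ : E → F}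

theorem integral_fderiv_segment (hφ : ContDiff ℝ 1 φ) (x h : E) :
    ∫ t in Ioc (0 : ℝ) 1, fderiv ℝ φ (x + t • h) h = φ (x + h) - φ x := by
  have hline (t : ℝ) : HasDerivAt (fun t : ℝ => x + t • h) h t := by
    simpa using ((hasDerivAt_id t).smul_const h).const_add x
  have hderiv (t : ℝ) : HasDerivAt (fun t : ℝ => φ (x + t • h)) (fderiv ℝ φ (x + t • h) h) t :=
    (hφ.differentiable one_ne_zero (x + t • h)).hasFDerivAt.comp_hasDerivAt t (hline t)
  have hcont : Continuous fun t : ℝ => fderiv ℝ φ (x + t • h) h := by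
    have := hφ.continuous_fderiv one_ne_zero
    fun_prop
  rw [← intervalIntegral.integral_of_le zero_le_one,
    intervalIntegral.integral_eq_sub_of_hasDerivAt (fun t _ => hderiv t)
      (hcont.intervalIntegrable _ _)]
  simp

theorem enorm_sub_translate_sq_le (hφ : ContDiff ℝ 1 φ) (x h : E) :
    ‖φ x - φ (x + h)‖ₑ ^ 2 ≤
      ∫⁻ t in Ioc (0 : ℝ) 1, ‖h‖ₑ ^ 2 * ‖fderiv ℝ φ (x + t • h)‖ₑ ^ 2 := by
  have hcont : Continuous fun t : ℝ => fderiv ℝ φ (x + t • h) h := by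
    have := hφ.continuous_fderiv one_ne_zero
    fun_prop
  rw [← enorm_neg, neg_sub, ← integral_fderiv_segment hφ]
  refine (enorm_integral_sq_le hcont.aestronglyMeasurable.restrict).trans ?_
  rw [Measure.restrict_apply_univ, Real.volume_Ioc, sub_zero, ENNReal.ofReal_one, one_mul]
  refine lintegral_mono fun t => ?_
  rw [← mul_pow, mul_comm]
  gcongr
  exact ContinuousLinearMap.le_opENorm _ _

variable [FiniteDimensional ℝ E] [MeasurableSpace E] [BorelSpace E] (μ : Measure E)
  [μ.IsAddHaarMeasure]

theorem lintegral_enorm_sub_translate_sq_le (hφ : ContDiff ℝ 1 φ) (h : E) :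
    ∫⁻ x, ‖φ x - φ (x + h)‖ₑ ^ 2 ∂μ ≤ ‖h‖ₑ ^ 2 * ∫⁻ x, ‖fderiv ℝ φ x‖ₑ ^ 2 ∂μ := by
  have hmeas : Measurable fun p : E × ℝ => ‖h‖ₑ ^ 2 * ‖fderiv ℝ φ (p.1 + p.2 • h)‖ₑ ^ 2 := by
    have hcont : Continuous fun p : E × ℝ => ‖fderiv ℝ φ (p.1 + p.2 • h)‖ₑ := by
      have := hφ.continuous_fderiv one_ne_zero
      fun_prop
    exact (hcont.measurable.pow_const 2).const_mul _
  calc ∫⁻ x, ‖φ x - φ (x + h)‖ₑ ^ 2 ∂μ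
      ≤ ∫⁻ x, ∫⁻ t in Ioc (0 : ℝ) 1, ‖h‖ₑ ^ 2 * ‖fderiv ℝ φ (x + t • h)‖ₑ ^ 2 ∂volume ∂μ :=
        lintegral_mono fun x => enorm_sub_translate_sq_le hφ x h
    _ = ∫⁻ t in Ioc (0 : ℝ) 1, ∫⁻ x, ‖h‖ₑ ^ 2 * ‖fderiv ℝ φ (x + t • h)‖ₑ ^ 2 ∂μ :=
        lintegral_lintegral_swap hmeas.aemeasurable
    _ = ∫⁻ _ in Ioc (0 : ℝ) 1, ‖h‖ₑ ^ 2 * ∫⁻ x, ‖fderiv ℝ φ x‖ₑ ^ 2 ∂μ := by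
        refine lintegral_congr fun t => ?_
        rw [lintegral_const_mul' _ _ (by simp),
          lintegral_add_right_eq_self (fun x => ‖fderiv ℝ φ x‖ₑ ^ 2) (t • h)]
    _ = ‖h‖ₑ ^ 2 * ∫⁻ x, ‖fderiv ℝ φ x‖ₑ ^ 2 ∂μ := by simp

theorem enorm_sub_setAverage_sq_le_lintegral_closedBall (hφ : Continuous φ) {s : Set E} {x : E}
    {r : ℝ} (hs : MeasurableSet s) (h0 : μ s ≠ 0) (hsr : s ⊆ Metric.closedBall x r) :
    ‖φ x - ⨍ y in s, φ y ∂μ‖ₑ ^ 2 ≤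
      (μ s)⁻¹ * ∫⁻ h in Metric.closedBall 0 r, ‖φ x - φ (x + h)‖ₑ ^ 2 ∂μ := by
  have hball := isCompact_closedBall x r
  have hinteg : IntegrableOn φ s μ := (hφ.continuousOn.integrableOn_compact hball).mono_set hsr
  refine (enorm_sub_setAverage_sq_le hinteg h0
    ((measure_mono hsr).trans_lt hball.measure_lt_top).ne (φ x)).trans ?_
  gcongr (μ s)⁻¹ * ?_
  rw [← lintegral_indicator hs, ← lintegral_indicator Metric.isClosed_closedBall.measurableSet,
    ← lintegral_add_left_eq_self _ x]
  refine lintegral_mono fun h => ?_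
  by_cases hx : x + h ∈ s
  · have hh : h ∈ Metric.closedBall 0 r := by simpa using hsr hx
    rw [indicator_of_mem hx, indicator_of_mem hh]
  · rw [indicator_of_notMem hx]
    exact zero_le

theorem lintegral_enorm_sub_setAverage_sq_le (hφ : ContDiff ℝ 1 φ) {Q : E → Set E} {V : ℝ≥0∞}
    {r : ℝ} (hQ : ∀ x, MeasurableSet (Q x)) (hV : ∀ x, μ (Q x) = V) (hV0 : V ≠ 0)
    (hQr : ∀ x, Q x ⊆ Metric.closedBall x r) :
    ∫⁻ x, ‖φ x - ⨍ y in Q x, φ y ∂μ‖ₑ ^ 2 ∂μ ≤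
      V⁻¹ * (μ (Metric.closedBall 0 r) * ENNReal.ofReal r ^ 2) *
        ∫⁻ x, ‖fderiv ℝ φ x‖ₑ ^ 2 ∂μ := by
  have hmeas : Measurable fun p : E × E => ‖φ p.1 - φ (p.1 + p.2)‖ₑ ^ 2 := by
    have hcont : Continuous fun p : E × E => ‖φ p.1 - φ (p.1 + p.2)‖ₑ := by
      have := hφ.continuous
      fun_prop
    exact hcont.measurable.pow_const 2
  calc ∫⁻ x, ‖φ x - ⨍ y in Q x, φ y ∂μ‖ₑ ^ 2 ∂μ
      ≤ ∫⁻ x, V⁻¹ * ∫⁻ h in Metric.closedBall 0 r, ‖φ x - φ (x + h)‖ₑ ^ 2 ∂μ ∂μ := by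
        refine lintegral_mono fun x => ?_
        rw [← hV x]
        exact enorm_sub_setAverage_sq_le_lintegral_closedBall μ hφ.continuous (hQ x)
          (by rwa [hV]) (hQr x)
    _ = V⁻¹ * ∫⁻ h in Metric.closedBall 0 r, ∫⁻ x, ‖φ x - φ (x + h)‖ₑ ^ 2 ∂μ ∂μ := by
        rw [lintegral_const_mul' _ _ (ENNReal.inv_ne_top.mpr hV0),
          lintegral_lintegral_swap hmeas.aemeasurable]
    _ ≤ V⁻¹ * ∫⁻ _ in Metric.closedBall 0 r,
          ENNReal.ofReal r ^ 2 * ∫⁻ x, ‖fderiv ℝ φ x‖ₑ ^ 2 ∂μ ∂μ := by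
        gcongr V⁻¹ * ?_
        refine setLIntegral_mono' Metric.isClosed_closedBall.measurableSet fun h hh =>
          (lintegral_enorm_sub_translate_sq_le μ hφ h).trans ?_
        gcongr
        rw [← ofReal_norm]
        exact ENNReal.ofReal_le_ofReal (mem_closedBall_zero_iff.mp hh)
    _ = V⁻¹ * (μ (Metric.closedBall 0 r) * ENNReal.ofReal r ^ 2) *
          ∫⁻ x, ‖fderiv ℝ φ x‖ₑ ^ 2 ∂μ := by
        rw [setLIntegral_const]
        ring

end Translation

section Grid

open BoxIntegral.unitPartition

variable (N : ℕ) [NeZero N]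

/-- The cell with index `k` of the grid of width `1 / N` in `ℝⁿ`: the half-open box of Mathlib's
unit partition, which lives in `Fin n → ℝ`, transported to the Euclidean space. -/
def gridCell (k : Fin n → ℤ) : Set (EuclideanSpace ℝ (Fin n)) :=
  WithLp.ofLp ⁻¹' (box N k : Set (Fin n → ℝ))

theorem mem_gridCell_iff_index {k : Fin n → ℤ} {x : EuclideanSpace ℝ (Fin n)} :
    x ∈ gridCell N k ↔ index N x.ofLp = k :=
  mem_box_iff_index

theorem measurableSet_gridCell (k : Fin n → ℤ) : MeasurableSet (gridCell N k) :=
  (PiLp.volume_preserving_ofLp (Fin n)).measurable (box N k).measurableSet_coe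

theorem volume_gridCell (k : Fin n → ℤ) : volume (gridCell N k) = ((N : ℝ≥0∞) ^ n)⁻¹ := by
  rw [gridCell, (PiLp.volume_preserving_ofLp (Fin n)).measure_preimage
    (box N k).measurableSet_coe.nullMeasurableSet, volume_box, Fintype.card_fin, one_div]

theorem volume_gridCell_ne_top (k : Fin n → ℤ) : volume (gridCell N k) ≠ ⊤ := by
  simp [volume_gridCell, NeZero.ne N]

theorem gridCell_subset_closedBall {k : Fin n → ℤ} {x : EuclideanSpace ℝ (Fin n)}
    (hx : x ∈ gridCell N k) : gridCell N k ⊆ Metric.closedBall x ((N : ℝ)⁻¹ * √n) := by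
  intro y hy
  have hcoord (i : Fin n) : dist (y i) (x i) ^ 2 ≤ ((N : ℝ)⁻¹) ^ 2 := by
    have hyi := mem_box_iff.mp hy i
    have hxi := mem_box_iff.mp hx i
    rw [add_div, one_div] at hyi hxi
    gcongr
    exact abs_sub_le_iff.mpr ⟨by linarith [hyi.2, hxi.1], by linarith [hxi.2, hyi.1]⟩
  rw [Metric.mem_closedBall, EuclideanSpace.dist_eq, Real.sqrt_le_left (by positivity), mul_pow,
    Real.sq_sqrt n.cast_nonneg]
  refine (Finset.sum_le_sum fun i _ => hcoord i).trans_eq ?_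
  simp [mul_comm]

theorem exists_finset_index_mem {s : Set (EuclideanSpace ℝ (Fin n))}
    (hs : Bornology.IsBounded s) : ∃ S : Finset (Fin n → ℤ), ∀ x ∈ s, index N x.ofLp ∈ S := by
  have himage : Bornology.IsBounded (WithLp.ofLp '' s) :=
    (PiLp.lipschitzWith_ofLp 2 _).isBounded_image hs
  obtain ⟨B, hB, hsB⟩ := BoxIntegral.le_hasIntegralVertices_of_isBounded himage
  exact ⟨admissibleIndex N B, fun x hx =>
    mem_admissibleIndex_of_mem_box N hB (hsB (mem_image_of_mem _ hx))⟩

theorem lintegral_enorm_sub_gridCell_average_sq_le {F : Type*} [NormedAddCommGroup F]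
    [NormedSpace ℝ F] [CompleteSpace F] {φ : EuclideanSpace ℝ (Fin n) → F} (hφ : ContDiff ℝ 1 φ) :
    ∫⁻ x, ‖φ x - ⨍ y in gridCell N (index N x.ofLp), φ y‖ₑ ^ 2 ≤
      volume (Metric.closedBall (0 : EuclideanSpace ℝ (Fin n)) √n) * n / N ^ 2 *
        ∫⁻ x, ‖fderiv ℝ φ x‖ₑ ^ 2 := by
  have hN : (N : ℝ≥0∞) ^ n ≠ 0 := by simp [NeZero.ne N]
  have hNtop : (N : ℝ≥0∞) ^ n ≠ ⊤ := by simp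
  refine (lintegral_enorm_sub_setAverage_sq_le volume hφ
    (Q := fun x => gridCell N (index N x.ofLp)) (fun x => measurableSet_gridCell N _)
    (fun x => volume_gridCell N _) (ENNReal.inv_ne_zero.mpr hNtop)
    (fun x => gridCell_subset_closedBall N ((mem_gridCell_iff_index N).mpr rfl))).trans_eq ?_
  have hradius : ENNReal.ofReal ((N : ℝ)⁻¹ * √n) ^ 2 = ((N : ℝ≥0∞) ^ 2)⁻¹ * n := by
    rw [← ENNReal.ofReal_pow (by positivity), mul_pow, Real.sq_sqrt n.cast_nonneg,
      ENNReal.ofReal_mul (by positivity), inv_pow,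
      ENNReal.ofReal_inv_of_pos (pow_pos (Nat.cast_pos.mpr (NeZero.pos N)) _),
      ENNReal.ofReal_pow N.cast_nonneg]
    simp
  rw [Measure.addHaar_closedBall_mul _ _ (by positivity) (Real.sqrt_nonneg n),
    finrank_euclideanSpace_fin, hradius, inv_inv, inv_pow,
    ENNReal.ofReal_inv_of_pos (pow_pos (Nat.cast_pos.mpr (NeZero.pos N)) _),
    ENNReal.ofReal_pow N.cast_nonneg, ENNReal.ofReal_natCast, ENNReal.div_eq_inv_mul,
    mul_assoc ((N : ℝ≥0∞) ^ n)⁻¹, ENNReal.mul_inv_cancel_left hN hNtop]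
  ring

variable (P : EllipticOperator n)

/-- The indicator function of a grid cell as an element of `L²(Ω)`. -/
def gridIndicator (k : Fin n → ℤ) : L2 P :=
  indicatorConstLp 2 (measurableSet_gridCell N k)
    ((Measure.restrict_le_self _).trans_lt (volume_gridCell_ne_top N k).lt_top).ne 1

theorem gridIndicator_ae_eq (k : Fin n → ℤ) :
    gridIndicator N P k =ᵐ[volume.restrict P.Ω] (gridCell N k).indicator fun _ => 1 :=
  indicatorConstLp_coeFn

/-- Replacing a function on `Ω`, extended by zero, by its averages over the grid cells with
indices in `S`; the factor `N ^ n` is the inverse volume of a cell. -/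
def gridAverage (S : Finset (Fin n → ℤ)) : L2 P →L[ℝ] L2 P :=
  ∑ k ∈ S, (N : ℝ) ^ n • InnerProductSpace.rankOne ℝ (gridIndicator N P k) (gridIndicator N P k)

theorem isCompactOperator_gridAverage (S : Finset (Fin n → ℤ)) :
    IsCompactOperator (gridAverage N P S) := by
  have hmem : gridAverage N P S ∈ compactOperator (RingHom.id ℝ) (L2 P) (L2 P) :=
    Submodule.sum_mem _ fun k _ => Submodule.smul_mem _ _ <|
      (isCompactOperator_of_locallyCompactSpace_dom
        (innerSL ℝ (gridIndicator N P k) : L2 P →L[ℝ] ℝ)).clm_comp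
          (ContinuousLinearMap.toSpanSingleton ℝ (gridIndicator N P k))
  exact hmem

variable {P} {w : L2 P} {φ : EuclideanSpace ℝ (Fin n) → ℝ}

theorem pow_mul_inner_gridIndicator (hw : w =ᵐ[volume.restrict P.Ω] φ)
    (hφ : ∀ x, x ∉ P.Ω → φ x = 0) (k : Fin n → ℤ) :
    (N : ℝ) ^ n * inner ℝ (gridIndicator N P k) w = ⨍ y in gridCell N k, φ y := by
  have hinner : inner ℝ (gridIndicator N P k) w = ∫ y in gridCell N k, φ y := by
    rw [gridIndicator, L2.inner_indicatorConstLp_one, integral_congr_ae (ae_restrict_of_ae hw),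
      Measure.restrict_restrict (measurableSet_gridCell N k), inter_comm,
      ← Measure.restrict_restrict P.isOpen.measurableSet]
    exact setIntegral_eq_integral_of_forall_compl_eq_zero hφ
  rw [hinner, setAverage_eq, measureReal_def, volume_gridCell]
  simp

theorem gridAverage_ae_eq {S : Finset (Fin n → ℤ)} (hS : ∀ x ∈ P.Ω, index N x.ofLp ∈ S)
    (hw : w =ᵐ[volume.restrict P.Ω] φ) (hφ : ∀ x, x ∉ P.Ω → φ x = 0) :
    gridAverage N P S w =ᵐ[volume.restrict P.Ω]
      fun x => ⨍ y in gridCell N (index N x.ofLp), φ y := by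
  have hexpand : gridAverage N P S w =
      ∑ k ∈ S, (⨍ y in gridCell N k, φ y) • gridIndicator N P k := by
    simp only [gridAverage, sum_apply, smul_apply, InnerProductSpace.rankOne_apply, smul_smul,
      pow_mul_inner_gridIndicator N hw hφ]
  rw [hexpand]
  filter_upwards [Lp.coeFn_finsetSum S fun k => (⨍ y in gridCell N k, φ y) • gridIndicator N P k,
    ae_all_iff.mpr fun k => Lp.coeFn_smul (⨍ y in gridCell N k, φ y) (gridIndicator N P k),
    ae_all_iff.mpr (gridIndicator_ae_eq N P), ae_restrict_mem P.isOpen.measurableSet]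
    with x hsum hsmul hind hx
  rw [hsum, Finset.sum_apply, Finset.sum_eq_single_of_mem _ (hS x hx)]
  · rw [hsmul, Pi.smul_apply, hind, indicator_of_mem ((mem_gridCell_iff_index N).mpr rfl)]
    simp
  · intro k _ hk
    rw [hsmul, Pi.smul_apply, hind,
      indicator_of_notMem fun h => hk ((mem_gridCell_iff_index N).mp h).symm, smul_zero]

end Grid

theorem enorm_sq_eq_lintegral_fderiv {P : EllipticOperator n} {φ : EuclideanSpace ℝ (Fin n) → ℝ}
    (hφ : tsupport φ ⊆ P.Ω) {G : L2Vec P} (hG : G =ᵐ[volume.restrict P.Ω] gradient φ) :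
    ‖G‖ₑ ^ 2 = ∫⁻ x, ‖fderiv ℝ φ x‖ₑ ^ 2 := by
  have hzero : (fun x => ‖fderiv ℝ φ x‖ₑ ^ 2).support ⊆ P.Ω := by
    intro x hx
    refine hφ (support_fderiv_subset ℝ fun h => hx ?_)
    simp [← ofReal_norm, h]
  rw [enorm_sq_eq_lintegral, ← setLIntegral_eq_of_support_subset hzero]
  refine lintegral_congr_ae ?_
  filter_upwards [hG] with x hx
  rw [hx, gradient, LinearIsometryEquiv.enorm_map]

theorem enorm_sub_gridAverage_sq_le (N : ℕ) [NeZero N] {P : EllipticOperator n}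
    {S : Finset (Fin n → ℤ)} (hS : ∀ x ∈ P.Ω, BoxIntegral.unitPartition.index N x.ofLp ∈ S)
    {p : L2 P × L2Vec P} (hp : p ∈ testPairs P) :
    ‖p.1 - gridAverage N P S p.1‖ₑ ^ 2 ≤
      volume (Metric.closedBall (0 : EuclideanSpace ℝ (Fin n)) √n) * n / N ^ 2 * ‖p.2‖ₑ ^ 2 := by
  obtain ⟨φ, hφ, -, hsupp, hw, hG⟩ := hp
  have hzero : ∀ x, x ∉ P.Ω → φ x = 0 := fun x hx =>
    image_eq_zero_of_notMem_tsupport fun h => hx (hsupp h)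
  rw [enorm_sq_eq_lintegral_fderiv hsupp hG]
  refine le_trans ?_ (lintegral_enorm_sub_gridCell_average_sq_le N (hφ.of_le (by simp)))
  rw [enorm_sq_eq_lintegral]
  refine (lintegral_congr_ae ?_).trans_le (setLIntegral_le_lintegral P.Ω _)
  filter_upwards [Lp.coeFn_sub p.1 (gridAverage N P S p.1), hw, gridAverage_ae_eq N hS hw hzero]
    with x hsub hwx havg
  rw [hsub, Pi.sub_apply, hwx, havg]

theorem exists_isCompactOperator_norm_sub_le (P : EllipticOperator n) {δ : ℝ} (hδ : 0 < δ) :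
    ∃ K : L2 P →L[ℝ] L2 P, IsCompactOperator K ∧ ∀ p ∈ H10 P, ‖p.1 - K p.1‖ ≤ δ * ‖p.2‖ := by
  set C := volume (Metric.closedBall (0 : EuclideanSpace ℝ (Fin n)) √n) * n
  have hC : C ≠ ⊤ := ENNReal.mul_ne_top measure_closedBall_lt_top.ne (by simp)
  obtain ⟨N, hN⟩ := ENNReal.exists_nat_mul_gt (a := ENNReal.ofReal δ ^ 2) (by simpa) hC
  have : NeZero N := ⟨by rintro rfl; simp at hN⟩
  have hCN : C / N ^ 2 ≤ ENNReal.ofReal δ ^ 2 := by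
    have hN1 : (1 : ℝ≥0∞) ≤ N := by exact_mod_cast NeZero.one_le
    refine ENNReal.div_le_of_le_mul' (hN.le.trans ?_)
    gcongr
    exact le_self_pow hN1 two_ne_zero
  obtain ⟨S, hS⟩ := exists_finset_index_mem N P.bounded
  refine ⟨gridAverage N P S, isCompactOperator_gridAverage N P S, fun p hp => ?_⟩
  have hclosed : IsClosed {p : L2 P × L2Vec P | ‖p.1 - gridAverage N P S p.1‖ ≤ δ * ‖p.2‖} :=
    isClosed_le (by fun_prop) (by fun_prop)
  refine closure_minimal (fun q hq => ?_) hclosed hp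
  have hsq := (enorm_sub_gridAverage_sq_le N hS hq).trans (mul_le_mul_left hCN _)
  rw [← mul_pow, ENNReal.pow_le_pow_left_iff two_ne_zero] at hsq
  simpa [ENNReal.toReal_mul, hδ.le] using ENNReal.toReal_mono (by finiteness) hsq

/-! ### Compact self-adjoint operators and coercive forms -/

section Spectral

variable {𝕜 E : Type*} [RCLike 𝕜] [NormedAddCommGroup E] [InnerProductSpace 𝕜 E]

theorem isCompactOperator_of_forall_norm_sub_le {𝕂 X Y : Type*} [NontriviallyNormedField 𝕂]
    [NormedAddCommGroup X] [NormedSpace 𝕂 X] [NormedAddCommGroup Y] [NormedSpace 𝕂 Y]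
    [CompleteSpace Y] {J : X →L[𝕂] Y}
    (hJ : ∀ δ > 0, ∃ K : X →L[𝕂] Y, IsCompactOperator K ∧ ∀ x, ‖J x - K x‖ ≤ δ * ‖x‖) :
    IsCompactOperator J := by
  suffices hmem : J ∈ closure {F : X →L[𝕂] Y | IsCompactOperator F} by
    rwa [isClosed_setOfPred_isCompactOperator.closure_eq] at hmem
  refine Metric.mem_closure_iff.mpr fun δ hδ => ?_
  obtain ⟨K, hK, hJK⟩ := hJ (δ / 2) (half_pos hδ)
  refine ⟨K, hK, ?_⟩
  rw [dist_eq_norm]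
  exact (ContinuousLinearMap.opNorm_le_bound _ (half_pos hδ).le hJK).trans_lt (half_lt_self hδ)

theorem countable_of_orthonormal [TopologicalSpace.SeparableSpace E] {ι : Type*} {v : ι → E}
    (hv : Orthonormal 𝕜 v) : Countable ι := by
  refine Pairwise.countable_of_isOpen_disjoint (s := fun i => Metric.ball (v i) (1 / 2))
    (fun i j hij => Metric.ball_disjoint_ball ?_) (fun i => Metric.isOpen_ball)
    fun i => Metric.nonempty_ball.mpr (by norm_num)
  have hdist : ‖v i - v j‖ ^ 2 = 2 := by
    rw [@norm_sub_sq 𝕜, hv.1 i, hv.1 j, hv.2 hij, map_zero]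
    norm_num
  rw [dist_eq_norm]
  nlinarith [norm_nonneg (v i - v j)]

theorem exists_hilbertBasis_nat_of_orthonormal [CompleteSpace E]
    [TopologicalSpace.SeparableSpace E] (hdim : ¬FiniteDimensional 𝕜 E) {ι : Type*} {v : ι → E}
    (hv : Orthonormal 𝕜 v) (hspan : (Submodule.span 𝕜 (range v))ᗮ = ⊥) :
    ∃ (e : ℕ ≃ ι) (b : HilbertBasis ℕ 𝕜 E), ⇑b = v ∘ e := by
  have : Countable ι := countable_of_orthonormal hv
  have : Infinite ι := by
    refine not_finite_iff_infinite.mp fun _ => hdim ?_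
    have := Fintype.ofFinite ι
    exact (HilbertBasis.mkOfOrthogonalEqBot hv hspan).toOrthonormalBasis.toBasis
      |>.finiteDimensional_of_finite
  obtain ⟨_⟩ := nonempty_denumerable ι
  let e : ℕ ≃ ι := (Denumerable.eqv ι).symm
  refine ⟨e, HilbertBasis.mkOfOrthogonalEqBot (v := v ∘ e) (hv.comp e e.injective) ?_,
    HilbertBasis.coe_mkOfOrthogonalEqBot _ _⟩
  rwa [e.surjective.range_comp]

theorem exists_orthonormal_eigenvectors [CompleteSpace E] {S : E →L[𝕜] E}
    (hc : IsCompactOperator S) (hs : S.IsSymmetric) :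
    ∃ (w : (μ : 𝕜) → Set (Module.End.eigenspace (S : Module.End 𝕜 E) μ)),
      Orthonormal 𝕜 (fun i : Σ μ, w μ => (i.2 : E)) ∧
      (Submodule.span 𝕜 (range fun i : Σ μ, w μ => (i.2 : E)))ᗮ = ⊥ := by
  have hcomplete (μ : 𝕜) : CompleteSpace (Module.End.eigenspace (S : Module.End 𝕜 E) μ) := by
    have hclosed : IsClosed {x | S x = μ • x} :=
      isClosed_eq S.continuous (continuous_const_smul μ)
    simp only [← ContinuousLinearMap.coe_coe, ← Module.End.mem_eigenspace_iff] at hclosed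
    exact hclosed.completeSpace_coe
  choose w b hb using fun μ =>
    exists_hilbertBasis 𝕜 (Module.End.eigenspace (S : Module.End 𝕜 E) μ)
  refine ⟨w, hs.orthogonalFamily_eigenspaces.orthonormal_sigma_orthonormal
    fun μ => hb μ ▸ (b μ).orthonormal, ?_⟩
  rw [eq_bot_iff, ← ContinuousLinearMap.orthogonalComplement_iSup_eigenspaces_eq_bot hc hs,
    ← Submodule.iInf_orthogonal]
  refine fun x hx => (Submodule.mem_iInf _).mpr fun μ => (Submodule.mem_orthogonal' _ _).mpr
    fun y hy => ?_
  have hdense := Submodule.dense_iff_topologicalClosure_eq_top.mpr (b μ).dense_span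
  have hinner : (innerSL 𝕜 x).comp (Module.End.eigenspace (S : Module.End 𝕜 E) μ).subtypeL = 0 := by
    refine ContinuousLinearMap.ext_on hdense ?_
    rw [hb μ, Subtype.range_coe]
    exact fun z hz =>
      (Submodule.mem_orthogonal' _ _).mp hx _ (Submodule.subset_span ⟨⟨μ, z, hz⟩, rfl⟩)
  exact DFunLike.congr_fun hinner ⟨y, hy⟩

theorem exists_hilbertBasis_eigenvectors [CompleteSpace E] [TopologicalSpace.SeparableSpace E]
    (hdim : ¬FiniteDimensional 𝕜 E) {S : E →L[𝕜] E} (hc : IsCompactOperator S)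
    (hs : S.IsSymmetric) :
    ∃ (b : HilbertBasis ℕ 𝕜 E) (μ : ℕ → 𝕜), ∀ k, S (b k) = μ k • b k := by
  obtain ⟨w, hw, hspan⟩ := exists_orthonormal_eigenvectors hc hs
  obtain ⟨e, b, hb⟩ := exists_hilbertBasis_nat_of_orthonormal hdim hw hspan
  refine ⟨b, fun k => (e k).1, fun k => ?_⟩
  rw [hb]
  exact Module.End.mem_eigenspace_iff.mp (e k).2.1.2

end Spectral

section LaxMilgram

variable {V H : Type*} [NormedAddCommGroup V] [InnerProductSpace ℝ V] [NormedAddCommGroup H]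
  [InnerProductSpace ℝ H] {a : V →L[ℝ] V →L[ℝ] ℝ}

theorem eq_zero_of_isCoercive (ha : IsCoercive a) {p : V} (hp : a p p = 0) : p = 0 := by
  obtain ⟨C, hC, hCa⟩ := ha
  have hle : C * ‖p‖ * ‖p‖ ≤ 0 := (hCa p).trans hp.le
  by_contra hne
  have := norm_pos_iff.mpr hne
  exact hle.not_gt (by positivity)

variable [CompleteSpace V] [CompleteSpace H]

/-- The solution operator of a coercive variational problem: given a coercive form `a` on `V` and a
bounded map `J : V → H` (in applications an embedding), it sends `f : H` to the `p : V` with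
`a p q = ⟪f, J q⟫` for all `q : V`, as provided by the Lax–Milgram theorem. -/
def solutionOperator (ha : IsCoercive a) (J : V →L[ℝ] H) : H →L[ℝ] V :=
  (ha.continuousLinearEquivOfBilin.symm : V →L[ℝ] V) ∘L ContinuousLinearMap.adjoint J

theorem apply_solutionOperator (ha : IsCoercive a) (J : V →L[ℝ] H) (f : H) (q : V) :
    a (solutionOperator ha J f) q = inner ℝ f (J q) := by
  rw [← ha.continuousLinearEquivOfBilin_apply, ← ContinuousLinearMap.adjoint_inner_left]
  exact congrArg (inner ℝ · q) (ha.continuousLinearEquivOfBilin.apply_symm_apply _)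

theorem isSymmetric_comp_solutionOperator (ha : IsCoercive a) (hsymm : ∀ p q, a p q = a q p)
    (J : V →L[ℝ] H) : (J ∘L solutionOperator ha J).IsSymmetric := fun f g =>
  calc inner ℝ (J (solutionOperator ha J f)) g
      = a (solutionOperator ha J g) (solutionOperator ha J f) := by
        rw [apply_solutionOperator, real_inner_comm]
    _ = inner ℝ f (J (solutionOperator ha J g)) := by rw [hsymm, apply_solutionOperator]

theorem eq_zero_of_comp_solutionOperator_eq_zero (ha : IsCoercive a) {J : V →L[ℝ] H}
    (hdense : DenseRange J) {f : H} (hf : J (solutionOperator ha J f) = 0) : f = 0 := by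
  have hsol : solutionOperator ha J f = 0 :=
    eq_zero_of_isCoercive ha (by rw [apply_solutionOperator, hf, inner_zero_right])
  refine Dense.eq_zero_of_inner_left (𝕜 := ℝ) hdense ?_
  rintro _ ⟨q, rfl⟩
  rw [← apply_solutionOperator ha, hsol, map_zero, zero_apply]

theorem exists_hilbertBasis_eigenpairs_of_isCoercive [TopologicalSpace.SeparableSpace H]
    (hdim : ¬FiniteDimensional ℝ H) (ha : IsCoercive a) (hsymm : ∀ p q, a p q = a q p)
    {J : V →L[ℝ] H} (hcompact : IsCompactOperator J) (hdense : DenseRange J) :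
    ∃ (b : HilbertBasis ℕ ℝ H) (ev : ℕ → ℝ) (p : ℕ → V),
      ∀ k, J (p k) = b k ∧ ∀ q, a (p k) q = ev k * inner ℝ (b k) (J q) := by
  obtain ⟨b, μ, hb⟩ := exists_hilbertBasis_eigenvectors hdim
    (hcompact.comp_clm (solutionOperator ha J)) (isSymmetric_comp_solutionOperator ha hsymm J)
  have hμ (k : ℕ) : μ k ≠ 0 := fun hμk => b.orthonormal.ne_zero k <|
    eq_zero_of_comp_solutionOperator_eq_zero ha hdense ((hb k).trans (by rw [hμk, zero_smul]))
  refine ⟨b, fun k => (μ k)⁻¹, fun k => (μ k)⁻¹ • solutionOperator ha J (b k), fun k => ⟨?_, ?_⟩⟩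
  · rw [map_smul]
    exact (inv_smul_eq_iff₀ (hμ k)).mpr (hb k)
  · intro q
    rw [map_smul, smul_apply, apply_solutionOperator, smul_eq_mul]

end LaxMilgram

/-! ### The space `H¹₀(Ω)` -/

section H10

variable (P : EllipticOperator n)

theorem zero_mem_testPairs : 0 ∈ testPairs P := by
  refine ⟨0, contDiff_const, HasCompactSupport.zero, by simp [tsupport], Lp.coeFn_zero _ _ _, ?_⟩
  rw [show gradient (0 : EuclideanSpace ℝ (Fin n) → ℝ) = 0 from gradient_const' 0]
  exact Lp.coeFn_zero _ _ _

variable {P}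

theorem add_mem_testPairs {p q : L2 P × L2Vec P} (hp : p ∈ testPairs P) (hq : q ∈ testPairs P) :
    p + q ∈ testPairs P := by
  obtain ⟨φ, hφ, hφc, hφs, hpφ, hpφ'⟩ := hp
  obtain ⟨ψ, hψ, hψc, hψs, hqψ, hqψ'⟩ := hq
  refine ⟨φ + ψ, hφ.add hψ, hφc.add hψc, (tsupport_add _ _).trans (union_subset hφs hψs),
    (Lp.coeFn_add p.1 q.1).trans (hpφ.add hqψ), (Lp.coeFn_add p.2 q.2).trans ?_⟩
  refine (hpφ'.add hqψ').trans (.of_eq (funext fun x => ?_))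
  rw [Pi.add_apply, gradient, gradient, gradient,
    fderiv_add (hφ.differentiable (by simp) x) (hψ.differentiable (by simp) x), map_add]

theorem smul_mem_testPairs (r : ℝ) {p : L2 P × L2Vec P} (hp : p ∈ testPairs P) :
    r • p ∈ testPairs P := by
  obtain ⟨φ, hφ, hφc, hφs, hpφ, hpφ'⟩ := hp
  refine ⟨r • φ, hφ.const_smul r, hφc.smul_left, ?_,
    (Lp.coeFn_smul r p.1).trans (hpφ.const_smul r), (Lp.coeFn_smul r p.2).trans ?_⟩
  · exact (tsupport_smul_subset_right (fun _ => r) φ).trans hφs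
  refine (hpφ'.const_smul r).trans (.of_eq (funext fun x => ?_))
  rw [Pi.smul_apply, gradient, gradient, fderiv_const_smul (hφ.differentiable (by simp) x),
    map_smulₛₗ, conj_trivial]

variable (P)

/-- The pairs `(φ, ∇φ)` with `φ ∈ C_c^∞(Ω)`, as a subspace. -/
def testSubmodule : Submodule ℝ (L2 P × L2Vec P) where
  carrier := testPairs P
  zero_mem' := zero_mem_testPairs P
  add_mem' := add_mem_testPairs
  smul_mem' r _ := smul_mem_testPairs r

/-- `H¹₀(Ω)` as a Hilbert space: the set `H10 P` as a closed subspace of the `ℓ²`-product of `L²(Ω)`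
and `L²(Ω; ℝⁿ)`, whose norm induces the `H¹` norm. -/
def H10Submodule : Submodule ℝ (WithLp 2 (L2 P × L2Vec P)) :=
  (testSubmodule P).topologicalClosure.comap
    (WithLp.prodContinuousLinearEquiv 2 ℝ (L2 P) (L2Vec P) : _ →ₗ[ℝ] L2 P × L2Vec P)

theorem mem_H10Submodule {p : WithLp 2 (L2 P × L2Vec P)} :
    p ∈ H10Submodule P ↔ (p.fst, p.snd) ∈ H10 P := Iff.rfl

instance : CompleteSpace (H10Submodule P) :=
  ((testSubmodule P).isClosed_topologicalClosure.preimage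
    (WithLp.prodContinuousLinearEquiv 2 ℝ (L2 P) (L2Vec P)).continuous).completeSpace_coe

/-- The inclusion of `H¹₀(Ω)` in `L²(Ω)`. -/
def H10Inclusion : H10Submodule P →L[ℝ] L2 P :=
  WithLp.fstL 2 ℝ (L2 P) (L2Vec P) ∘L (H10Submodule P).subtypeL

theorem isCompactOperator_H10Inclusion : IsCompactOperator (H10Inclusion P) := by
  refine isCompactOperator_of_forall_norm_sub_le fun δ hδ => ?_
  obtain ⟨K, hK, hKδ⟩ := exists_isCompactOperator_norm_sub_le P hδ
  refine ⟨K ∘L H10Inclusion P, hK.comp_clm (H10Inclusion P), fun p => ?_⟩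
  calc ‖p.1.fst - K p.1.fst‖ ≤ δ * ‖p.1.snd‖ := hKδ _ ((mem_H10Submodule P).mp p.2)
    _ ≤ δ * ‖p‖ := by gcongr; exact WithLp.norm_snd_le ..

instance : IsFiniteMeasure (volume.restrict P.Ω) :=
  isFiniteMeasure_restrict.mpr P.bounded.measure_lt_top.ne

/-- `Ω` as a bundled open set, so that `𝓓(domain P, ℝ)` is `C_c^∞(Ω)`. -/
abbrev domain : TopologicalSpace.Opens (EuclideanSpace ℝ (Fin n)) := ⟨P.Ω, P.isOpen⟩

variable {P}

theorem exists_mem_H10_ae_eq (φ : 𝓓(domain P, ℝ)) :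
    ∃ q ∈ H10 P, q.1 =ᵐ[volume.restrict P.Ω] φ := by
  have hφ : MemLp φ 2 (volume.restrict P.Ω) :=
    φ.continuous.memLp_of_hasCompactSupport φ.hasCompactSupport
  have hcont : Continuous (gradient φ) :=
    (LinearIsometryEquiv.continuous _).comp (φ.contDiff.continuous_fderiv (by simp))
  have hsupp : HasCompactSupport (gradient φ) :=
    (φ.hasCompactSupport.fderiv ℝ).comp_left (g := (InnerProductSpace.toDual ℝ _).symm)
      (map_zero _)
  have hgrad : MemLp (gradient φ) 2 (volume.restrict P.Ω) :=
    hcont.memLp_of_hasCompactSupport hsupp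
  exact ⟨(hφ.toLp φ, hgrad.toLp _), subset_closure ⟨φ, φ.contDiff, φ.hasCompactSupport,
    φ.tsupport_subset, hφ.coeFn_toLp, hgrad.coeFn_toLp⟩, hφ.coeFn_toLp⟩

theorem eq_zero_of_forall_inner_H10 {f : L2 P} (hf : ∀ q ∈ H10 P, inner ℝ q.1 f = 0) : f = 0 := by
  have hinteg : IntegrableOn f (domain P) := (Lp.memLp f).integrable (by norm_num)
  refine Lp.ext ((ae_eq_zero_of_forall_testFunction hinteg fun φ => ?_).trans
    (Lp.coeFn_zero _ _ _).symm)
  obtain ⟨q, hq, hqφ⟩ := exists_mem_H10_ae_eq φ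
  rw [← hf q hq, L2.inner_def]
  refine integral_congr_ae ?_
  filter_upwards [hqφ] with x hx
  simp [hx, mul_comm]

variable (P)

theorem denseRange_H10Inclusion : DenseRange (H10Inclusion P) := by
  refine Submodule.dense_iff_topologicalClosure_eq_top (s := (H10Inclusion P).range) |>.mpr ?_
  refine (Submodule.topologicalClosure_eq_top_iff).mpr ((Submodule.eq_bot_iff _).mpr fun f hf => ?_)
  exact eq_zero_of_forall_inner_H10 fun q hq =>
    (Submodule.mem_orthogonal _ _).mp hf _ ⟨⟨WithLp.toLp 2 q, hq⟩, rfl⟩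

end H10

/-! ### The bilinear form of `𝓛` -/

section WeightedInner

variable {α : Type*} [MeasurableSpace α] {μ : Measure α} {w : α → ℝ}

/-- The bounded bilinear form `(u, v) ↦ ∫ w u v` on `L²`, for a weight `w ∈ L^∞`. -/
def weightedInner (hw : MemLp w ⊤ μ) : Lp ℝ 2 μ →L[ℝ] Lp ℝ 2 μ →L[ℝ] ℝ :=
  innerSL ℝ ∘L (ContinuousLinearMap.mul ℝ ℝ).holderL μ ⊤ 2 2 (hw.toLp w)

theorem weightedInner_apply (hw : MemLp w ⊤ μ) (u v : Lp ℝ 2 μ) :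
    weightedInner hw u v = ∫ x, w x * u x * v x ∂μ := by
  calc weightedInner hw u v
      = ∫ x, inner ℝ ((ContinuousLinearMap.mul ℝ ℝ).holder 2 (hw.toLp w) u x) (v x) ∂μ :=
        L2.inner_def _ _
    _ = ∫ x, w x * u x * v x ∂μ := by
        refine integral_congr_ae ?_
        filter_upwards [(ContinuousLinearMap.mul ℝ ℝ).coeFn_holder (r := 2) (hw.toLp w) u,
          hw.coeFn_toLp] with x hmul hwx
        rw [hmul, hwx, ContinuousLinearMap.mul_apply', RCLike.inner_apply', conj_trivial]

theorem integrable_weight_mul_mul (hw : MemLp w ⊤ μ) {u v : α → ℝ} (hu : MemLp u 2 μ)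
    (hv : MemLp v 2 μ) : Integrable (fun x => w x * u x * v x) μ := by
  have hwu : MemLp (fun x => w x * u x) 2 μ := hu.mul hw
  exact hwu.integrable_mul hv

end WeightedInner

theorem memLp_top_restrict_of_lipschitzOnWith {α F : Type*} [PseudoMetricSpace α]
    [SecondCountableTopology α] [MeasurableSpace α] [OpensMeasurableSpace α]
    [NormedAddCommGroup F] {μ : Measure α} {s : Set α} {f : α → F} {K : ℝ≥0}
    (hf : LipschitzOnWith K f s) (hs : Bornology.IsBounded s) (hsm : MeasurableSet s) :
    MemLp f ⊤ (μ.restrict s) := by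
  rcases s.eq_empty_or_nonempty with rfl | ⟨x₀, hx₀⟩
  · simp
  refine memLp_top_of_bound (hf.continuousOn.aestronglyMeasurable hsm)
    (‖f x₀‖ + K * Metric.diam s) ((ae_restrict_mem hsm).mono fun x hx => ?_)
  calc ‖f x‖ ≤ ‖f x₀‖ + dist (f x) (f x₀) := by
        rw [dist_eq_norm]
        exact norm_le_norm_add_norm_sub' _ _
    _ ≤ ‖f x₀‖ + K * dist x x₀ := by
        gcongr
        exact hf.dist_le_mul x hx x₀ hx₀
    _ ≤ ‖f x₀‖ + K * Metric.diam s := by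
        gcongr
        exact Metric.dist_le_diam_of_mem hs hx hx₀

section Form

variable (P : EllipticOperator n)

theorem memLp_top_coeff (i j : Fin n) : MemLp (fun x => P.A x i j) ⊤ (volume.restrict P.Ω) := by
  obtain ⟨K, hK⟩ := P.lipschitz
  exact memLp_top_restrict_of_lipschitzOnWith (hK i j) P.bounded P.isOpen.measurableSet

/-- The `i`-th component of a vector field. -/
def component (i : Fin n) : L2Vec P →L[ℝ] L2 P :=
  (EuclideanSpace.proj (𝕜 := ℝ) i).compLpL 2 (volume.restrict P.Ω)

theorem component_ae_eq (i : Fin n) (G : L2Vec P) :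
    component P i G =ᵐ[volume.restrict P.Ω] fun x => G x i :=
  (EuclideanSpace.proj (𝕜 := ℝ) i).coeFn_compLp G

/-- `form P` as a bounded bilinear form on the Hilbert space `H¹₀(Ω)`. -/
def formCLM : H10Submodule P →L[ℝ] H10Submodule P →L[ℝ] ℝ :=
  let grad (i : Fin n) : H10Submodule P →L[ℝ] L2 P :=
    component P i ∘L WithLp.sndL 2 ℝ (L2 P) (L2Vec P) ∘L (H10Submodule P).subtypeL
  (∑ i, ∑ j, (weightedInner (memLp_top_coeff P i j)).bilinearComp (grad j) (grad i)) +
    (weightedInner P.c_memLp).bilinearComp (H10Inclusion P) (H10Inclusion P)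

theorem formCLM_apply (p q : H10Submodule P) :
    formCLM P p q = form P (p.1.fst, p.1.snd) (q.1.fst, q.1.snd) := by
  have hcomp (G : L2Vec P) (i : Fin n) : MemLp (fun x => G x i) 2 (volume.restrict P.Ω) :=
    (memLp_congr_ae (component_ae_eq P i G)).mp (Lp.memLp _)
  have hterm (i j : Fin n) := integrable_weight_mul_mul (memLp_top_coeff P i j)
    (hcomp p.1.snd j) (hcomp q.1.snd i)
  rw [form, integral_add (integrable_finsetSum _ fun i _ => integrable_finsetSum _ fun j _ =>
    hterm i j) (integrable_weight_mul_mul P.c_memLp (Lp.memLp _) (Lp.memLp _)),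
    integral_finsetSum _ fun i _ => integrable_finsetSum _ fun j _ => hterm i j]
  simp only [integral_finsetSum _ fun j _ => hterm _ j, formCLM, add_apply, sum_apply,
    ContinuousLinearMap.bilinearComp_apply, weightedInner_apply]
  congr 1
  refine Finset.sum_congr rfl fun i _ => Finset.sum_congr rfl fun j _ => integral_congr_ae ?_
  filter_upwards [component_ae_eq P j p.1.snd, component_ae_eq P i q.1.snd] with x hp hq
  exact congrArg₂ (P.A x i j * · * ·) hp hq

theorem form_comm (p q : L2 P × L2Vec P) : form P p q = form P q p := by
  refine setIntegral_congr_fun P.isOpen.measurableSet fun x hx => ?_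
  have hsymm (i j : Fin n) : P.A x i j = P.A x j i := (P.symmetric x hx).apply j i
  simp only
  rw [Finset.sum_comm]
  simp only [hsymm, mul_right_comm]

theorem formCLM_comm (p q : H10Submodule P) : formCLM P p q = formCLM P q p := by
  rw [formCLM_apply, formCLM_apply, form_comm]

theorem isCoercive_formCLM : IsCoercive (formCLM P) := by
  obtain ⟨K, hK, hpoincare⟩ := poincare P
  obtain ⟨α, hα, hcoercive⟩ := form_coercive P
  refine ⟨α / (K + 1), by positivity, fun p => ?_⟩
  have hp : ‖p.1.fst‖ ^ 2 ≤ K * ‖p.1.snd‖ ^ 2 := hpoincare _ ((mem_H10Submodule P).mp p.2)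
  have hnorm : ‖p‖ ^ 2 = ‖p.1.fst‖ ^ 2 + ‖p.1.snd‖ ^ 2 := WithLp.prod_norm_sq_eq_of_L2 p.1
  calc α / (K + 1) * ‖p‖ * ‖p‖ = α / (K + 1) * (‖p.1.fst‖ ^ 2 + ‖p.1.snd‖ ^ 2) := by
        rw [mul_assoc, ← sq, hnorm]
    _ ≤ α / (K + 1) * ((K + 1) * ‖p.1.snd‖ ^ 2) := by gcongr; linarith
    _ = α * ‖p.1.snd‖ ^ 2 := by field_simp
    _ ≤ formCLM P p p := (hcoercive _).trans_eq (formCLM_apply P p p).symm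

end Form

/-! ### Existence of an eigenbasis -/

section Eigenbasis

theorem not_finiteDimensional_Lp_two_of_disjoint {α : Type*} [MeasurableSpace α] {μ : Measure α}
    {s : ℕ → Set α} (hs : ∀ k, MeasurableSet (s k)) (hpos : ∀ k, μ (s k) ≠ 0)
    (htop : ∀ k, μ (s k) ≠ ⊤) (hdisj : Pairwise (Function.onFun Disjoint s)) :
    ¬FiniteDimensional ℝ (Lp ℝ 2 μ) := by
  intro _
  let χ (k : ℕ) : Lp ℝ 2 μ := indicatorConstLp 2 (hs k) (htop k) 1
  have hinner (i j : ℕ) : inner ℝ (χ i) (χ j) = μ.real (s i ∩ s j) :=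
    L2.real_inner_indicatorConstLp_one_indicatorConstLp_one (hs i) (hs j) (htop i) (htop j)
  have hχ : LinearIndependent ℝ χ := by
    refine linearIndependent_of_ne_zero_of_inner_eq_zero (𝕜 := ℝ) (fun k hk => ?_) fun i j hij => ?_
    · have hzero := hinner k k
      rw [hk, inner_zero_left, inter_self] at hzero
      exact (ENNReal.toReal_pos (hpos k) (htop k)).ne hzero
    · exact (hinner i j).trans (by rw [(hdisj hij).inter_eq, measureReal_empty])
  have := hχ.finite_of_isNoetherian
  exact not_finite ℕ

theorem exists_seq_isOpen_subset_pairwise_disjoint {X : Type*} [TopologicalSpace X] [T2Space X]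
    {s : Set X} (hs : IsOpen s) (hinf : s.Infinite) :
    ∃ U : ℕ → Set X, (∀ k, IsOpen (U k) ∧ (U k).Nonempty ∧ U k ⊆ s) ∧
      Pairwise (Function.onFun Disjoint U) := by
  have := hinf.to_subtype
  obtain ⟨U, hinfinite, hopen, hdisj⟩ := exists_seq_infinite_isOpen_pairwise_disjoint s
  refine ⟨fun k => Subtype.val '' U k, fun k => ⟨hs.isOpenMap_subtype_val _ (hopen k),
    (hinfinite k).nonempty.image _, Subtype.coe_image_subset s (U k)⟩, fun i j hij => ?_⟩
  exact (disjoint_image_iff Subtype.val_injective).mpr (hdisj hij)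

variable (P : EllipticOperator n)

theorem not_finiteDimensional_L2 : ¬FiniteDimensional ℝ (L2 P) := by
  have : Nonempty (Fin n) := ⟨⟨0, P.one_le_dim⟩⟩
  obtain ⟨x, hx⟩ := P.nonempty
  have := Module.punctured_nhds_neBot ℝ (EuclideanSpace ℝ (Fin n)) x
  obtain ⟨U, hU, hdisj⟩ := exists_seq_isOpen_subset_pairwise_disjoint P.isOpen
    (infinite_of_mem_nhds x (P.isOpen.mem_nhds hx))
  refine not_finiteDimensional_Lp_two_of_disjoint (fun k => (hU k).1.measurableSet) (fun k => ?_)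
    (fun k => measure_ne_top _ _) hdisj
  rw [Measure.restrict_apply (hU k).1.measurableSet, inter_eq_left.mpr (hU k).2.2]
  exact ((hU k).1.measure_pos volume (hU k).2.1).ne'

theorem nonempty_eigenbasis : Nonempty (Eigenbasis P) := by
  have : Fact ((2 : ℝ≥0∞) ≠ ⊤) := ⟨by simp⟩
  obtain ⟨b, ev, p, hp⟩ := exists_hilbertBasis_eigenpairs_of_isCoercive
    (not_finiteDimensional_L2 P) (isCoercive_formCLM P) (formCLM_comm P)
    (isCompactOperator_H10Inclusion P) (denseRange_H10Inclusion P)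
  refine ⟨⟨ev, b, fun k => ⟨b.orthonormal.ne_zero k, (p k).1.snd, ?_⟩⟩⟩
  obtain ⟨hfst, hform⟩ := hp k
  rw [← hfst] at hform ⊢
  exact ⟨(p k).2, fun q hq =>
    (formCLM_apply P (p k) ⟨WithLp.toLp 2 q, hq⟩).symm.trans (hform ⟨WithLp.toLp 2 q, hq⟩)⟩

end Eigenbasis

end FracWave

end

open FracWave Eigenbasis.Hs in
theorem mainTheorem2_general {n : ℕ} (P : EllipticOperator n) :
    Nonempty (Eigenbasis P) ∧
    ∀ (s : ℝ≥0) (T : ℝ), 0 < T →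
      ∀ (B : Eigenbasis P) (f : Lp (L2 P) 2 (timeMeasure T)) (g : B.Hs s) (h : L2 P),
        (∃! u : Lp (B.Hs s) 2 (timeMeasure T), IsWeakSolution B s T f g h u) ∧
        ∀ (u : Lp (B.Hs s) 2 (timeMeasure T)) (u' : Lp (L2 P) 2 (timeMeasure T)),
          IsWeakSolution B s T f g h u →
          HasWeakTimeDeriv T (fun t => toL2 B s (u t)) u' →
          eLpNorm u ∞ (timeMeasure T) + eLpNorm u' ∞ (timeMeasure T) ≤
            ENNReal.ofReal (4 * (1 + √T) * (‖f‖ + ‖g‖ + ‖h‖)) :=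
  ⟨nonempty_eigenbasis P, fun _ _ hT _ f g h => ⟨existsUnique_isWeakSolution hT f g h,
    fun _ _ hu hu' => hu.eLpNorm_top_add_eLpNorm_top_le hT hu'⟩⟩

open FracWave Eigenbasis.Hs in
theorem mainTheorem2 {n : ℕ} (P : EllipticOperator n) :
    Nonempty (Eigenbasis P) ∧
    ∀ s : ℝ≥0, 0 < s → s < 1 → ∀ T : ℝ, 0 < T → ∃ C : ℝ, 0 < C ∧
      ∀ (B : Eigenbasis P) (f : Lp (L2 P) 2 (timeMeasure T)) (g : B.Hs s) (h : L2 P),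
        (∃! u : Lp (B.Hs s) 2 (timeMeasure T), IsWeakSolution B s T f g h u) ∧
        ∀ (u : Lp (B.Hs s) 2 (timeMeasure T)) (u' : Lp (L2 P) 2 (timeMeasure T)),
          IsWeakSolution B s T f g h u →
          HasWeakTimeDeriv T (fun t => toL2 B s (u t)) u' →
          eLpNorm u ∞ (timeMeasure T) + eLpNorm u' ∞ (timeMeasure T) ≤
            ENNReal.ofReal (C * (‖f‖ + ‖g‖ + ‖h‖)) := by
  exact ⟨(mainTheorem2_general P).1, fun s _ _ T hT =>
    ⟨4 * (1 + √T), by positivity, (mainTheorem2_general P).2 s T hT⟩⟩
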